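/- Let $n\ge 2$ and write points of $\mathbb R^n$ as $(t,x)\in\mathbb R\times\mathbb R^{n-1}$, dual variables as $(\tau,\xi)$. The Fourier transform is $\widehat\varphi(\tau,\xi)=\int_{\mathbb R^n}e^{-i(t\tau+x\cdot\xi)}\varphi(t,x)\,dt\,dx$ for $\varphi\in\mathcal S(\mathbb R^n)$, and $\langle\widehat T,\varphi\rangle=\langle T,\widehat\varphi\rangle$ for $T\in\mathcal S'(\mathbb R^n)$. Let $\Box=\partial_t^2-\Delta_x$. *Symbol.* For $\beta\in\mathbb C$ let $$\sigma_\beta=\lim_{\epsilon\to0^+}\big(|\xi|^2-(\tau-i\epsilon)^2\big)^{\beta}\quad\text{in }\mathcal S'(\mathbb R^n)\text{ (principal branch).}$$ *Powers of the wave operator.* For $f\in C_c^\infty(\mathbb R^n)$ let $\Box^\alpha f\in\mathcal S'(\mathbb R^n)$ be given by $\widehat{\Box^\alpha f}=\sigma_\alpha\widehat f$. *Riesz distributions.* Let $\mathcal K=\{(t,x):t^2\ge|x|^2,\ t\ge0\}$. For $\operatorname{Re}\alpha>\frac n2-1$ let $$\langle R_\alpha,\varphi\rangle=C_{n,\alpha}\int_{\mathcal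 K}(t^2-|x|^2)^{\alpha-\frac n2}\varphi(t,x)\,dt\,dx,\qquad C_{n,\alpha}=\frac{2^{1-2\alpha}\pi^{1-\frac n2}}{\Gamma(\alpha)\,\Gamma(\alpha+1-\frac n2)},\qquad \varphi\in\mathcal S(\mathbb R^n),$$ and for the other $\alpha\in\mathbb C$ let $R_\alpha=\Box^kR_{\alpha+k}$, where $k$ is the least natural number with $\operatorname{Re}\alpha+k>\frac n2-1$. The hyperbolic Riesz potential of $f\in C_c^\infty(\mathbb R^n)$ is $I_\alpha f=R_\alpha*f$, i.e. $I_\alpha f(t,x)=\langle R_\alpha,f((t,x)-\cdot)\rangle$. **Proposition.** (a) These objects are well defined. The integral defining $R_\alpha$ for $\operatorname{Re}\alpha>\frac n2-1$ converges absolutely (its kernel is integrable against some negative power of $1+|(t,x)|$), and $\alpha\mapsto\langle R_\alpha,\varphi\rangle$ is entire for every $\varphi\in\mathcal S(\mathbb R^n)$, so that $R_\alpha$ is the analytic continuation of that integral. For every $\beta\in\mathbb C$ and $\epsilon>0$ the function $(|\xi|^2-(\tau-i\epsilon)^2)^\beta$ is integrable against some negative power of $1+|(\tau,\xi)|$, and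 the limit defining $\sigma_\beta$ exists (weakly) in $\mathcal S'(\mathbb R^n)$. For $\operatorname{Re}\beta>-1$, $\sigma_\beta$ is the function, integrable against some negative power of $1+|(\tau,\xi)|$, that equals $(|\xi|^2-\tau^2)^\beta$ where $|\xi|^2>\tau^2$ and $e^{i\pi\beta\operatorname{sgn}\tau}(\tau^2-|\xi|^2)^\beta$ where $|\xi|^2<\tau^2$. For every $\varphi\in\mathcal S(\mathbb R^n)$, $\beta\mapsto\langle\sigma_\beta,\varphi\rangle$ is analytic on $\{\beta\in\mathbb C:\beta+\frac n2\notin\{0,-1,-2,\dots\}\}$. (b) Let $\alpha\in\mathbb C$ be such that $\alpha+\frac n2$ is not a non-positive integer. Then $$\widehat R_\alpha=\sigma_{-\alpha}$$ in $\mathcal S'(\mathbb R^n)$. Moreover, for every $f\in C_c^\infty(\mathbb R^n)$ the function $I_{-\alpha}f$ is continuous and integrable against some negative power of $1+|(t,x)|$, and $$\Box^\alpha f=I_{-\alpha}f$$ as tempered distributions. -/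

import Mathlib

open MeasureTheory Filter Topology
open scoped SchwartzMap FourierTransform LineDeriv ContDiff

noncomputable section

namespace FracWave

/-- The space `ℝⁿ = ℝ × ℝᵈ` with `n = d + 1`, with its Euclidean structure and Lebesgue measure.
The coordinate of index `0` is the time `t` (or its dual variable `τ`), the others are the
space variable `x` (or `ξ`). -/
abbrev Spacetime (d : ℕ) : Type := EuclideanSpace ℝ (Fin (d + 1))

variable {d : ℕ}

/-- The time coordinate `t`. -/
def time (z : Spacetime d) : ℝ := z 0

/-- The square `|x|²` of the Euclidean norm of the space variable. -/
def spaceSq (z : Spacetime d) : ℝ := ∑ i : Fin d, z i.succ ^ 2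

/-! ### Functions as tempered distributions -/

/-- `g` is integrable against some negative power of `1 + |z|`. -/
def IsTempered (g : Spacetime d → ℂ) : Prop :=
  ∃ N : ℕ, Integrable (fun z => (((1 + ‖z‖) ^ N)⁻¹ : ℝ) • g z)

theorem integrable_mul_schwartz {g : Spacetime d → ℂ} (hg : IsTempered g)
    (φ : 𝓢(Spacetime d, ℂ)) : Integrable (fun z => g z * φ z) := by
  obtain ⟨N, hN⟩ := hg
  have h := hN.mul_bdd (c := 2 ^ N * (Finset.Iic (N, 0)).sup
      (fun m : ℕ × ℕ => SchwartzMap.seminorm ℂ m.1 m.2) φ)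
    (g := fun z => (((1 + ‖z‖) ^ N : ℝ) : ℂ) * φ z)
    (by
      refine Continuous.aestronglyMeasurable ?_
      have := φ.continuous
      fun_prop)
    (Eventually.of_forall fun z => by
      have := SchwartzMap.one_add_le_sup_seminorm_apply (𝕜 := ℂ) (m := (N, 0))
        (le_refl N) (le_refl 0) φ z
      rw [norm_iteratedFDeriv_zero] at this
      rw [norm_mul, Complex.norm_real, Real.norm_of_nonneg (by positivity)]
      exact this)
  refine h.congr (Eventually.of_forall fun z => ?_)
  have h0 : (((1 + ‖z‖) ^ N : ℝ) : ℂ) ≠ 0 := by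
    have : (0 : ℝ) < (1 + ‖z‖) ^ N := by positivity
    exact_mod_cast this.ne'
  simp only [Complex.real_smul, Complex.ofReal_inv]
  field_simp

theorem norm_integral_mul_schwartz_le {g : Spacetime d → ℂ} (hg : IsTempered g) :
    ∃ (s : Finset (ℕ × ℕ)) (C : ℝ), 0 ≤ C ∧ ∀ φ : 𝓢(Spacetime d, ℂ),
      ‖∫ z, g z * φ z‖ ≤ C * s.sup (schwartzSeminormFamily ℂ (Spacetime d) ℂ) φ := by
  obtain ⟨N, hN⟩ := hg
  refine ⟨Finset.Iic (N, 0), (∫ z, ‖(((1 + ‖z‖) ^ N)⁻¹ : ℝ) • g z‖) * 2 ^ N, by positivity,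
    fun φ => ?_⟩
  rw [mul_assoc, ← integral_mul_const]
  refine norm_integral_le_of_norm_le (hN.norm.mul_const _) (Eventually.of_forall fun z => ?_)
  have h := SchwartzMap.one_add_le_sup_seminorm_apply (𝕜 := ℂ) (m := (N, 0))
    (le_refl N) (le_refl 0) φ z
  rw [norm_iteratedFDeriv_zero] at h
  have h0 : (0 : ℝ) < (1 + ‖z‖) ^ N := by positivity
  rw [norm_mul, norm_smul, Real.norm_of_nonneg (by positivity)]
  calc ‖g z‖ * ‖φ z‖ = ((1 + ‖z‖) ^ N)⁻¹ * ‖g z‖ * ((1 + ‖z‖) ^ N * ‖φ z‖) := by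
        field_simp
    _ ≤ _ := mul_le_mul_of_nonneg_left h (by positivity)

open Classical in
/-- The tempered distribution `φ ↦ ∫ g φ` of a function `g` (zero if `g` is not tempered). -/
def regularDist (g : Spacetime d → ℂ) : 𝓢'(Spacetime d, ℂ) :=
  if hg : IsTempered g then
    ContinuousLinearMap.toPointwiseConvergenceCLM _ _ _ _
      (SchwartzMap.mkCLMtoNormedSpace (𝕜 := ℂ) (σ := RingHom.id ℂ) (fun φ => ∫ z, g z * φ z)
        (fun φ ψ => by
          simp only [add_apply, mul_add]
          exact integral_add (integrable_mul_schwartz hg φ) (integrable_mul_schwartz hg ψ))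
        (fun a φ => by
          simp only [smul_apply, smul_eq_mul, RingHom.id_apply]
          rw [← integral_const_mul]
          congr 1
          ext z
          ring)
        (norm_integral_mul_schwartz_le hg))
  else 0

theorem regularDist_apply {g : Spacetime d → ℂ} (hg : IsTempered g)
    (φ : 𝓢(Spacetime d, ℂ)) : regularDist g φ = ∫ z, g z * φ z := by
  rw [regularDist, dif_pos hg]
  rfl

/-! ### The Fourier transform without `2π` in the exponent -/

/-- The dilation `z ↦ (2π)⁻¹ z`. -/
def dilation (d : ℕ) : Spacetime d ≃L[ℝ] Spacetime d :=
  ContinuousLinearEquiv.smulLeft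
    (Units.mk0 (2 * Real.pi)⁻¹ (inv_ne_zero (by positivity)))

/-- The Fourier transform `φ̂(τ, ξ) = ∫ e^{-i(tτ + x·ξ)} φ(t, x) dt dx` on Schwartz functions,
see `angularFourier_apply`. -/
def angularFourier (d : ℕ) : 𝓢(Spacetime d, ℂ) →L[ℂ] 𝓢(Spacetime d, ℂ) :=
  SchwartzMap.compCLMOfContinuousLinearEquiv ℂ (dilation d) ∘L
    FourierTransform.fourierCLM ℂ 𝓢(Spacetime d, ℂ)

/-- The inverse of `angularFourier`. -/
def angularFourierInv (d : ℕ) : 𝓢(Spacetime d, ℂ) →L[ℂ] 𝓢(Spacetime d, ℂ) :=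
  FourierTransform.fourierInvCLM ℂ 𝓢(Spacetime d, ℂ) ∘L
    SchwartzMap.compCLMOfContinuousLinearEquiv ℂ (dilation d).symm

theorem angularFourier_apply (φ : 𝓢(Spacetime d, ℂ)) (ζ : Spacetime d) :
    angularFourier d φ ζ = ∫ z, Complex.exp (-(Complex.I * (inner ℝ z ζ : ℝ))) * φ z := by
  have h : angularFourier d φ ζ = 𝓕 (φ : Spacetime d → ℂ) ((2 * Real.pi)⁻¹ • ζ) := rfl
  rw [h, Real.fourier_eq']
  congr 1
  ext z
  rw [smul_eq_mul, inner_smul_right]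
  congr 2
  push_cast
  have : (Real.pi : ℂ) ≠ 0 := by exact_mod_cast Real.pi_ne_zero
  field_simp

theorem angularFourier_inv (φ : 𝓢(Spacetime d, ℂ)) :
    angularFourier d (angularFourierInv d φ) = φ := by
  ext z
  simp [angularFourier, angularFourierInv]

theorem angularFourierInv_fourier (φ : 𝓢(Spacetime d, ℂ)) :
    angularFourierInv d (angularFourier d φ) = φ := by
  have h : SchwartzMap.compCLMOfContinuousLinearEquiv ℂ (dilation d).symm
      (SchwartzMap.compCLMOfContinuousLinearEquiv ℂ (dilation d) (𝓕 φ)) = 𝓕 φ := by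
    ext z
    simp
  simp [angularFourier, angularFourierInv, h]

/-- The Fourier transform of tempered distributions, `⟨T̂, φ⟩ = ⟨T, φ̂⟩`. -/
def distFourier (d : ℕ) : 𝓢'(Spacetime d, ℂ) →L[ℂ] 𝓢'(Spacetime d, ℂ) :=
  PointwiseConvergenceCLM.precomp ℂ (angularFourier d)

/-- The inverse Fourier transform of tempered distributions. -/
def distFourierInv (d : ℕ) : 𝓢'(Spacetime d, ℂ) →L[ℂ] 𝓢'(Spacetime d, ℂ) :=
  PointwiseConvergenceCLM.precomp ℂ (angularFourierInv d)

/-! ### The symbol and the powers of the wave operator -/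

/-- The function equal to `(|ξ|² - τ²)^β` where `|ξ|² > τ²`, to
`e^{iπβ sgn τ} (τ² - |ξ|²)^β` where `|ξ|² < τ²`, and to `0` on the light cone. -/
def symbol (d : ℕ) (β : ℂ) (ζ : Spacetime d) : ℂ :=
  if 0 < spaceSq ζ - time ζ ^ 2 then ((spaceSq ζ - time ζ ^ 2 : ℝ) : ℂ) ^ β
  else if 0 < time ζ ^ 2 - spaceSq ζ then
    Complex.exp (Complex.I * Real.pi * β * (Real.sign (time ζ) : ℝ)) *
      ((time ζ ^ 2 - spaceSq ζ : ℝ) : ℂ) ^ β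
  else 0

/-- The function `(|ξ|² - (τ - iε)²)^β`, with the principal branch of the power. -/
def regSymbol (d : ℕ) (ε : ℝ) (β : ℂ) (ζ : Spacetime d) : ℂ :=
  ((spaceSq ζ : ℂ) - ((time ζ : ℂ) - Complex.I * ε) ^ 2) ^ β

/-- The symbol `σ_β = lim_{ε → 0⁺} (|ξ|² - (τ - iε)²)^β` as a tempered distribution. -/
def symbolDist (d : ℕ) (β : ℂ) : 𝓢'(Spacetime d, ℂ) :=
  limUnder (𝓝[>] (0 : ℝ)) (fun ε => regularDist (regSymbol d ε β))

/-- The power `□^α f`, the tempered distribution with Fourier transform `σ_α f̂`. -/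
def boxPow (α : ℂ) (f : 𝓢(Spacetime d, ℂ)) : 𝓢'(Spacetime d, ℂ) :=
  distFourierInv d
    (TemperedDistribution.smulLeftCLM ℂ (angularFourier d f) (symbolDist d α))

theorem distFourier_boxPow (α : ℂ) (f : 𝓢(Spacetime d, ℂ)) :
    distFourier d (boxPow α f) =
      TemperedDistribution.smulLeftCLM ℂ (angularFourier d f) (symbolDist d α) := by
  ext φ
  change TemperedDistribution.smulLeftCLM ℂ (angularFourier d f) (symbolDist d α)
    (angularFourierInv d (angularFourier d φ)) = _
  rw [angularFourierInv_fourier]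

/-! ### Riesz distributions and Riesz potentials -/

/-- The wave operator `□ = ∂_t² - Δ_x` on tempered distributions. -/
def box (T : 𝓢'(Spacetime d, ℂ)) : 𝓢'(Spacetime d, ℂ) :=
  ∂_{(EuclideanSpace.single 0 1 : Spacetime d)} (∂_{(EuclideanSpace.single 0 1 : Spacetime d)} T) -
    ∑ i : Fin d, ∂_{(EuclideanSpace.single i.succ 1 : Spacetime d)}
      (∂_{(EuclideanSpace.single i.succ 1 : Spacetime d)} T)

/-- The forward causal cone `t² ≥ |x|²`, `t ≥ 0`. -/
def causalCone (d : ℕ) : Set (Spacetime d) :=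
  {z | spaceSq z ≤ time z ^ 2 ∧ 0 ≤ time z}

/-- The constant `C_{n,α} = 2^{1-2α} π^{1-n/2} / (Γ(α) Γ(α+1-n/2))`, with `n = d + 1`. -/
def rieszConst (d : ℕ) (α : ℂ) : ℂ :=
  (2 : ℂ) ^ (1 - 2 * α) * (Real.pi : ℂ) ^ (1 - ((d : ℂ) + 1) / 2) /
    (Complex.Gamma α * Complex.Gamma (α + 1 - ((d : ℂ) + 1) / 2))

/-- The function equal to `C_{n,α} (t² - |x|²)^{α-n/2}` on the forward causal cone and to `0`
elsewhere. -/
def rieszKernel (d : ℕ) (α : ℂ) : Spacetime d → ℂ :=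
  (causalCone d).indicator fun z =>
    rieszConst d α * ((time z ^ 2 - spaceSq z : ℝ) : ℂ) ^ (α - ((d : ℂ) + 1) / 2)

/-- The least natural number `k` with `Re α + k > n/2 - 1`. -/
def rieszShift (d : ℕ) (α : ℂ) : ℕ :=
  sInf {k : ℕ | ((d : ℝ) + 1) / 2 - 1 < α.re + k}

/-- The Riesz distribution `R_α`: it is given by the function `rieszKernel d α` if
`Re α > n/2 - 1` (then `rieszShift d α = 0`), and in general by the identity
`R_α = □^k R_{α+k}`. -/
def rieszDist (d : ℕ) (α : ℂ) : 𝓢'(Spacetime d, ℂ) :=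
  box^[rieszShift d α] (regularDist (rieszKernel d (α + rieszShift d α)))

theorem rieszDist_of_lt {α : ℂ} (hα : ((d : ℝ) + 1) / 2 - 1 < α.re) :
    rieszDist d α = regularDist (rieszKernel d α) := by
  have h : rieszShift d α = 0 := by
    refine Nat.sInf_eq_zero.2 (Or.inl ?_)
    simpa using hα
  simp [rieszDist, h]

/-- The test function `w ↦ f (z - w)`. -/
def reflectTranslate (f : 𝓢(Spacetime d, ℂ)) (z : Spacetime d) : 𝓢(Spacetime d, ℂ) :=
  SchwartzMap.compSubConstCLM ℂ z
    (SchwartzMap.compCLMOfContinuousLinearEquiv ℂ (ContinuousLinearEquiv.neg ℝ) f)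

theorem reflectTranslate_apply (f : 𝓢(Spacetime d, ℂ)) (z w : Spacetime d) :
    reflectTranslate f z w = f (z - w) := by
  simp [reflectTranslate]

/-- The hyperbolic Riesz potential `I_α f = R_α * f`, that is `z ↦ ⟨R_α, f(z - ·)⟩`. -/
def rieszPotential (α : ℂ) (f : 𝓢(Spacetime d, ℂ)) (z : Spacetime d) : ℂ :=
  rieszDist d α (reflectTranslate f z)

end FracWave

end

open FracWave

/-!
The Riesz kernel and the symbol are tied together by the Laplace transform: if `Re α > n/2 - 1`,
then for every `ε > 0` the Fourier transform of the integrable function `e^{-εt} R_α` is exactly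
the regularized symbol `(|ξ|² - (τ - iε)²)^{-α}` (`integral_rieszKernel_mul_cexp`). To compute it,
replace `ε + iτ` by a real `s > 0`, substitute `q = t² - |x|²`, and write `e^{-sA} / A` with
`A = √(q + |x|²)` as a superposition of Gaussians `e^{-A²/v}` (`integral_subordination`). The
integrals in `x`, `q` and `v` are then a Gaussian and two Gamma integrals, absolutely convergent as
soon as `Re (α - n/2) > -1`. The identity theorem passes from real `s` to `Re s > 0`.

Pairing with a Schwartz function and letting `ε → 0` gives `σ_{-α} = R̂_α` for `Re α > n/2 - 1`.
For the other `α` no analytic continuation is needed: the regularized symbol for `α` is the one for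
`α + 1` times the polynomial `|ξ|² - (τ - iε)²`, which tends to the symbol of `□`. So the limit
exists for every `α` and equals the Fourier transform of `□^k R_{α+k}` for every admissible `k`
(`tendsto_regSymbol_iterate`). This shows at once that `□^k R_{α+k}` does not depend on `k`
(`rieszDist_apply`), that `σ_{-α} = R̂_α` for every `α` (`symbolDist_eq`), and, as `k` can be kept
fixed locally, that both sides are entire in `α` (`differentiable_rieszDist`).

For `Re β > -1` the regularized symbols converge pointwise off the light cone and are dominated by
`|τ² - |ξ|²|^{Re β}` or by a polynomial, hence `σ_β` is a function (`symbolDist_eq_regularDist`).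
All the temperedness claims rest on the integrability of `|t² - |x|²|^a` against a weight, for
`a > -1` (`isTempered_abs_sq_sub_rpow`).

Finally `I_α f` is the convolution of a tempered function with the Schwartz function `□^k f`
(`rieszPotential_eq`), and `□^α f = I_{-α} f` follows from `R̂_{-α} = σ_α` by Fubini's theorem
(`boxPow_eq_regularDist`).
-/

noncomputable section

namespace FracWave

variable {d : ℕ}

/-! ### One-variable integrals -/

/-- A multiple of the error function. -/
theorem exists_gaussian_primitive :
    ∃ E : ℝ → ℝ, (∀ w, HasDerivAt E (Real.exp (-w ^ 2)) w) ∧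
      Tendsto E atTop (𝓝 (√Real.pi / 2)) ∧ Tendsto E atBot (𝓝 (-(√Real.pi / 2))) := by
  have hc : Continuous fun y : ℝ => Real.exp (-y ^ 2) := by fun_prop
  have hi : Integrable fun y : ℝ => Real.exp (-y ^ 2) := by
    simpa using integrable_exp_neg_mul_sq one_pos
  have hI : ∫ y in Set.Ioi (0 : ℝ), Real.exp (-y ^ 2) = √Real.pi / 2 := by
    simpa using integral_gaussian_Ioi 1
  have hI' : ∫ y in Set.Iic (0 : ℝ), Real.exp (-y ^ 2) = √Real.pi / 2 := by
    rw [← hI, ← neg_zero, ← integral_comp_neg_Ioi]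
    simp
  refine ⟨fun w => ∫ y in (0 : ℝ)..w, Real.exp (-y ^ 2), fun w => ?_, ?_, ?_⟩
  · exact intervalIntegral.integral_hasDerivAt_right (hc.intervalIntegrable _ _)
      (hc.stronglyMeasurableAtFilter _ _) hc.continuousAt
  · rw [← hI]
    exact intervalIntegral_tendsto_integral_Ioi 0 hi.integrableOn tendsto_id
  · rw [← hI']
    have := (intervalIntegral_tendsto_integral_Iic 0 hi.integrableOn tendsto_id).neg
    refine this.congr fun w => ?_
    rw [intervalIntegral.integral_symm]
    simp

/-- The subordination formula, which writes `e^{-sA} / A` as a superposition of the Gaussians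
`e^{-A²/v}`. -/
theorem integral_subordination {A s : ℝ} (hA : 0 < A) (hs : 0 < s) :
    ∫ v in Set.Ioi (0 : ℝ), v ^ (-(3 / 2) : ℝ) * Real.exp (-(A ^ 2 / v) - s ^ 2 * v / 4) =
      √Real.pi / A * Real.exp (-(s * A)) := by
  obtain ⟨E, hE, hEt, hEb⟩ := exists_gaussian_primitive
  -- `F` is a primitive of the integrand: `(A/√v ∓ s√v/2)² = A²/v + s²v/4 ∓ sA`, so its two terms
  -- contribute `A⁻¹ ((A/2) v^{-3/2} ± (s/4) v^{-1/2})` times the exponential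
  set F : ℝ → ℝ := fun v => A⁻¹ * (-(Real.exp (-(s * A)) * E (A / √v - s * √v / 2)) -
    Real.exp (s * A) * E (A / √v + s * √v / 2)) with hF
  set c : ℝ := A⁻¹ * (-(Real.exp (-(s * A)) * (√Real.pi / 2)) -
    Real.exp (s * A) * (√Real.pi / 2)) with hc
  -- `c` is the limit of `F` at `0`; the value of `F` itself there is junk
  have hsq : Tendsto (fun v : ℝ => √v) (𝓝[>] 0) (𝓝[>] 0) := by
    refine tendsto_nhdsWithin_iff.2 ⟨?_, ?_⟩
    · have := Real.continuous_sqrt.tendsto 0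
      rw [Real.sqrt_zero] at this
      exact this.mono_left nhdsWithin_le_nhds
    · filter_upwards [self_mem_nhdsWithin] with v hv
      exact Real.sqrt_pos.2 hv
  have hinv : Tendsto (fun v : ℝ => A / √v) (𝓝[>] 0) atTop :=
    (hsq.inv_tendsto_nhdsGT_zero).const_mul_atTop hA
  have hsm : Tendsto (fun v : ℝ => s * √v / 2) (𝓝[>] 0) (𝓝 0) := by
    have := ((hsq.mono_right nhdsWithin_le_nhds).const_mul s).div_const 2
    simpa using this
  have h0 : Tendsto F (𝓝[>] 0) (𝓝 c) := by
    refine ((((hEt.comp ?_).const_mul _).neg.sub ((hEt.comp ?_).const_mul _)).const_mul _)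
    · simpa [sub_eq_add_neg] using hinv.atTop_add hsm.neg
    · exact hinv.atTop_add hsm
  have hinf : Tendsto F atTop (𝓝 (A⁻¹ * (-(Real.exp (-(s * A)) * (-(√Real.pi / 2))) -
      Real.exp (s * A) * (√Real.pi / 2)))) := by
    have h1 : Tendsto (fun v : ℝ => A / √v) atTop (𝓝 0) :=
      tendsto_const_nhds.div_atTop Real.tendsto_sqrt_atTop
    have h2 : Tendsto (fun v : ℝ => s * √v / 2) atTop atTop :=
      (Real.tendsto_sqrt_atTop.const_mul_atTop hs).atTop_div_const two_pos
    refine ((((hEb.comp ?_).const_mul _).neg.sub ((hEt.comp ?_).const_mul _)).const_mul _)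
    · simpa [sub_eq_add_neg] using h1.add_atBot (tendsto_neg_atTop_atBot.comp h2)
    · exact h1.add_atTop h2
  have hd : ∀ v ∈ Set.Ioi (0 : ℝ), HasDerivAt (Function.update F 0 c)
      (v ^ (-(3 / 2) : ℝ) * Real.exp (-(A ^ 2 / v) - s ^ 2 * v / 4)) v := by
    intro v hv
    have hv : 0 < v := hv
    have hr : 0 < √v := Real.sqrt_pos.2 hv
    have hrr : √v ^ 2 = v := Real.sq_sqrt hv.le
    have hds := Real.hasDerivAt_sqrt hv.ne'
    have hdi : HasDerivAt (fun v : ℝ => A / √v) (-(A / (2 * √v ^ 3))) v := by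
      refine ((hds.inv hr.ne').const_mul A).congr_deriv ?_
      field_simp
    have hdm : HasDerivAt (fun v : ℝ => s * √v / 2) (s / (4 * √v)) v := by
      refine ((hds.const_mul s).div_const 2).congr_deriv ?_
      field_simp
      norm_num
    have hdF := ((((hE _).comp v (hdi.sub hdm)).const_mul (Real.exp (-(s * A)))).neg.sub
      (((hE _).comp v (hdi.add hdm)).const_mul (Real.exp (s * A)))).const_mul A⁻¹
    refine HasDerivAt.congr_of_eventuallyEq (f := F) ?_ ?_
    · refine hdF.congr_deriv ?_
      have h1 : A / √v * (s * √v / 2) = s * A / 2 := by field_simp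
      have h2 : A ^ 2 / v = (A / √v) ^ 2 := by rw [div_pow, hrr]
      have h3 : s ^ 2 * v / 4 = (s * √v / 2) ^ 2 := by rw [div_pow, mul_pow, hrr]; ring
      have e1 : Real.exp (-(s * A)) * Real.exp (-(A / √v - s * √v / 2) ^ 2) =
          Real.exp (-(A ^ 2 / v) - s ^ 2 * v / 4) := by
        rw [← Real.exp_add]
        congr 1
        linear_combination 2 * h1 + h2 + h3
      have e2 : Real.exp (s * A) * Real.exp (-(A / √v + s * √v / 2) ^ 2) =
          Real.exp (-(A ^ 2 / v) - s ^ 2 * v / 4) := by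
        rw [← Real.exp_add]
        congr 1
        linear_combination -2 * h1 + h2 + h3
      have e3 : v ^ (-(3 / 2) : ℝ) = (√v ^ 3)⁻¹ := by
        rw [Real.rpow_neg hv.le, Real.sqrt_eq_rpow, ← Real.rpow_natCast, ← Real.rpow_mul hv.le]
        norm_num
      simp only [Pi.sub_apply, Pi.add_apply, e3]
      rw [← mul_assoc, ← mul_assoc, e1, e2]
      field_simp
      ring
    · filter_upwards [lt_mem_nhds hv] with w hw
      exact Function.update_of_ne (ne_of_gt hw) _ _
  have hcont : ContinuousWithinAt (Function.update F 0 c) (Set.Ici 0) 0 := by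
    rw [continuousWithinAt_update_same, Set.Ici_sdiff_left]
    exact h0
  have hpos : ∀ v ∈ Set.Ioi (0 : ℝ),
      0 ≤ v ^ (-(3 / 2) : ℝ) * Real.exp (-(A ^ 2 / v) - s ^ 2 * v / 4) := fun v hv => by
    have : (0 : ℝ) < v := hv
    positivity
  have hlim : Tendsto (Function.update F 0 c) atTop (𝓝 (A⁻¹ * (-(Real.exp (-(s * A)) *
      (-(√Real.pi / 2))) - Real.exp (s * A) * (√Real.pi / 2)))) := by
    refine hinf.congr' ?_
    filter_upwards [eventually_gt_atTop 0] with w hw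
    exact (Function.update_of_ne (ne_of_gt hw) _ _).symm
  rw [integral_Ioi_of_hasDerivAt_of_nonneg hcont hd hpos hlim, Function.update_self, hc]
  ring

/-- The substitution `q = t² - ρ²`. -/
theorem integral_Ioi_sub_sq_cpow {ρ : ℝ} (hρ : 0 ≤ ρ) (g : ℝ → ℂ) (a : ℂ) :
    ∫ t in Set.Ioi ρ, ((t ^ 2 - ρ ^ 2 : ℝ) : ℂ) ^ a * g t =
      ∫ q in Set.Ioi (0 : ℝ), (1 / (2 * √(q + ρ ^ 2))) • ((q : ℂ) ^ a * g √(q + ρ ^ 2)) := by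
  have himg : (fun q : ℝ => √(q + ρ ^ 2)) '' Set.Ioi 0 = Set.Ioi ρ := by
    ext t
    constructor
    · rintro ⟨q, hq, rfl⟩
      exact Real.lt_sqrt_of_sq_lt (by simpa using hq)
    · intro ht
      have ht : ρ < t := ht
      refine ⟨t ^ 2 - ρ ^ 2, ?_, ?_⟩
      · have : 0 < (t - ρ) * (t + ρ) := mul_pos (by linarith) (by linarith)
        change 0 < t ^ 2 - ρ ^ 2
        linarith
      · change √(t ^ 2 - ρ ^ 2 + ρ ^ 2) = t
        rw [sub_add_cancel]
        exact Real.sqrt_sq (by linarith)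
  rw [← himg, integral_image_eq_integral_abs_deriv_smul measurableSet_Ioi
    (f' := fun q => 1 / (2 * √(q + ρ ^ 2)))]
  · refine setIntegral_congr_fun measurableSet_Ioi fun q hq => ?_
    have hq : (0 : ℝ) < q := hq
    rw [abs_of_nonneg (by positivity), Real.sq_sqrt (by positivity), add_sub_cancel_right]
  · intro q hq
    have hq : (0 : ℝ) < q := hq
    have h : HasDerivAt (fun q : ℝ => q + ρ ^ 2) 1 q := (hasDerivAt_id q).add_const _
    exact (h.sqrt (by positivity)).hasDerivWithinAt
  · intro q hq r hr h
    have hq : (0 : ℝ) < q := hq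
    have hr : (0 : ℝ) < r := hr
    have := (Real.sqrt_inj (by positivity) (by positivity)).1 h
    linarith

theorem integrableOn_cpow_mul_cexp_neg_mul {a : ℂ} (ha : -1 < a.re) {r : ℝ} (hr : 0 < r) :
    IntegrableOn (fun t : ℝ => (t : ℂ) ^ a * Complex.exp (-(r * t : ℝ))) (Set.Ioi 0) := by
  have h := integrableOn_rpow_mul_exp_neg_mul_rpow ha one_pos hr
  refine Integrable.mono' h ?_ ?_
  · refine ContinuousOn.aestronglyMeasurable ?_ measurableSet_Ioi
    intro t ht
    have ht : (0 : ℝ) < t := ht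
    refine ContinuousAt.continuousWithinAt ?_
    refine ContinuousAt.mul ?_ (by fun_prop)
    exact (Complex.continuousAt_ofReal_cpow_const _ _ (Or.inr ht.ne'))
  · filter_upwards [self_mem_ae_restrict measurableSet_Ioi] with t ht
    have ht : (0 : ℝ) < t := ht
    rw [norm_mul, Complex.norm_cpow_eq_rpow_re_of_pos ht, Complex.norm_exp]
    simp

/-! ### Splitting of space-time and temperedness of the powers of `t² - |x|²` -/

/-- The space variable `x`. -/
def space (z : Spacetime d) : EuclideanSpace ℝ (Fin d) := WithLp.toLp 2 fun i => z i.succ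

theorem norm_space_sq (z : Spacetime d) : ‖space z‖ ^ 2 = spaceSq z := by
  simp [EuclideanSpace.norm_sq_eq, space, spaceSq]

theorem norm_sq_eq (z : Spacetime d) : ‖z‖ ^ 2 = time z ^ 2 + ‖space z‖ ^ 2 := by
  simp [EuclideanSpace.norm_sq_eq, space, time, Fin.sum_univ_succ]

theorem inner_eq (z ζ : Spacetime d) :
    inner ℝ z ζ = time z * time ζ + inner ℝ (space z) (space ζ) := by
  simp [PiLp.inner_apply, space, time, Fin.sum_univ_succ, mul_comm]

@[fun_prop]
theorem continuous_time : Continuous (time : Spacetime d → ℝ) := by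
  unfold time
  fun_prop

@[fun_prop]
theorem continuous_space : Continuous (space : Spacetime d → EuclideanSpace ℝ (Fin d)) := by
  unfold space
  fun_prop

@[fun_prop]
theorem continuous_spaceSq : Continuous (spaceSq : Spacetime d → ℝ) := by
  unfold spaceSq
  fun_prop

/-- The splitting `ℝⁿ = ℝ × ℝᵈ` as a measurable equivalence. -/
def splitting (d : ℕ) : Spacetime d ≃ᵐ ℝ × EuclideanSpace ℝ (Fin d) :=
  ((MeasurableEquiv.toLp 2 (Fin (d + 1) → ℝ)).symm.trans
    (MeasurableEquiv.piFinSuccAbove (fun _ : Fin (d + 1) => ℝ) 0)).trans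
    ((MeasurableEquiv.refl ℝ).prodCongr (MeasurableEquiv.toLp 2 (Fin d → ℝ)))

theorem splitting_apply (z : Spacetime d) : splitting d z = (time z, space z) := rfl

theorem measurePreserving_splitting : MeasurePreserving (splitting d) := by
  refine MeasurePreserving.trans (MeasurePreserving.trans
    (EuclideanSpace.volume_preserving_symm_measurableEquiv_toLp _)
    (volume_preserving_piFinSuccAbove (fun _ : Fin (d + 1) => ℝ) 0)) ?_
  exact (MeasurePreserving.id volume).prod (PiLp.volume_preserving_toLp (Fin d))

theorem abs_time_le (z : Spacetime d) : |time z| ≤ ‖z‖ :=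
  abs_le_of_sq_le_sq (by rw [norm_sq_eq]; nlinarith [sq_nonneg ‖space z‖]) (norm_nonneg z)

theorem norm_space_le (z : Spacetime d) : ‖space z‖ ≤ ‖z‖ :=
  le_of_sq_le_sq (by rw [norm_sq_eq]; nlinarith [sq_nonneg (time z)]) (norm_nonneg z)

theorem ae_space_ne_zero (hd : 1 ≤ d) : ∀ᵐ z : Spacetime d, space z ≠ 0 := by
  have : Nonempty (Fin d) := ⟨⟨0, hd⟩⟩
  have h : ∀ᵐ p : ℝ × EuclideanSpace ℝ (Fin d), p.2 ≠ 0 :=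
    Measure.quasiMeasurePreserving_snd.ae (Measure.ae_ne volume 0)
  exact measurePreserving_splitting.quasiMeasurePreserving.ae h

theorem integrable_mul_comp_sub {X : Type*} [MeasurableSpace X] {μ : Measure X} [SFinite μ]
    {g c : X → ℝ} {h : ℝ → ℝ} (hg : Integrable g μ) (hh : Integrable h) (hgm : Measurable g)
    (hhm : Measurable h) (hc : Measurable c) :
    Integrable (fun p : ℝ × X => g p.2 * h (p.1 - c p.2)) (volume.prod μ) := by
  rw [integrable_prod_iff' (by fun_prop)]
  refine ⟨Eventually.of_forall fun x => (hh.comp_sub_right (c x)).const_mul (g x), ?_⟩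
  simp only [norm_mul]
  have : ∀ x, ∫ t, ‖g x‖ * ‖h (t - c x)‖ = ‖g x‖ * ∫ t, ‖h t‖ := fun x => by
    rw [integral_const_mul, integral_sub_right_eq_self (fun t => ‖h t‖)]
  simp only [this]
  exact hg.norm.mul_const _

theorem integrable_rpow_norm_mul {a : ℝ} (ha : -1 < a) (ha0 : a ≤ 0) (hd : 1 ≤ d) :
    Integrable fun x : EuclideanSpace ℝ (Fin d) => ‖x‖ ^ a * ((1 + ‖x‖) ^ (d + 1))⁻¹ := by
  have : Nonempty (Fin d) := ⟨⟨0, hd⟩⟩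
  refine (integrable_fun_norm_addHaar volume
    (f := fun y : ℝ => y ^ a * ((1 + y) ^ (d + 1))⁻¹)).2 ?_
  have hm : Measurable fun y : ℝ => y ^ (Module.finrank ℝ (EuclideanSpace ℝ (Fin d)) - 1) •
      (y ^ a * ((1 + y) ^ (d + 1))⁻¹) := by fun_prop
  rw [← Set.Ioc_union_Ioi_eq_Ioi zero_le_one]
  rw [finrank_euclideanSpace_fin] at hm ⊢
  refine IntegrableOn.union ?_ ?_
  · have h : IntegrableOn (fun y : ℝ => y ^ a) (Set.Ioc 0 1) := by
      rw [← intervalIntegrable_iff_integrableOn_Ioc_of_le zero_le_one]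
      exact intervalIntegral.intervalIntegrable_rpow' ha
    refine Integrable.mono' h hm.aestronglyMeasurable ?_
    filter_upwards [self_mem_ae_restrict measurableSet_Ioc] with y hy
    obtain ⟨h0, h1⟩ := hy
    rw [smul_eq_mul, Real.norm_of_nonneg (by positivity)]
    have e1 : y ^ (d - 1) ≤ 1 := pow_le_one₀ h0.le h1
    have e2 : ((1 + y) ^ (d + 1))⁻¹ ≤ 1 := inv_le_one_of_one_le₀ (one_le_pow₀ (by linarith))
    calc y ^ (d - 1) * (y ^ a * ((1 + y) ^ (d + 1))⁻¹) ≤ 1 * (y ^ a * 1) := by gcongr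
      _ = y ^ a := by ring
  · have h : IntegrableOn (fun y : ℝ => y ^ (-2 : ℝ)) (Set.Ioi 1) :=
      integrableOn_Ioi_rpow_of_lt (by norm_num) one_pos
    refine Integrable.mono' h hm.aestronglyMeasurable ?_
    filter_upwards [self_mem_ae_restrict measurableSet_Ioi] with y hy
    have hy : 1 < y := hy
    have h0 : 0 < y := by linarith
    rw [smul_eq_mul, Real.norm_of_nonneg (by positivity)]
    have e1 : y ^ a ≤ 1 := Real.rpow_le_one_of_one_le_of_nonpos hy.le ha0
    have e2 : y ^ (-2 : ℝ) = y ^ (d - 1) * (y ^ (d + 1))⁻¹ := by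
      rw [Real.rpow_neg h0.le, eq_mul_inv_iff_mul_eq₀ (by positivity)]
      have : d + 1 = (d - 1) + 2 := by omega
      rw [this, pow_add]
      norm_cast
      field_simp
    rw [e2]
    have e3 : ((1 + y) ^ (d + 1))⁻¹ ≤ (y ^ (d + 1))⁻¹ := by gcongr; linarith
    calc y ^ (d - 1) * (y ^ a * ((1 + y) ^ (d + 1))⁻¹)
        ≤ y ^ (d - 1) * (1 * (y ^ (d + 1))⁻¹) := by gcongr
      _ = _ := by ring

/-- The singular part of `|u|^a`, extended by zero outside `(-1, 1)`. -/
def truncatedPow (a u : ℝ) : ℝ := (Set.Ioo (-1) 1).indicator (fun u => |u| ^ a) u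

theorem measurable_truncatedPow (a : ℝ) : Measurable (truncatedPow a) :=
  Measurable.indicator (by fun_prop) measurableSet_Ioo

theorem truncatedPow_nonneg (a u : ℝ) : 0 ≤ truncatedPow a u :=
  Set.indicator_nonneg (fun _ _ => by positivity) _

theorem truncatedPow_neg (a u : ℝ) : truncatedPow a (-u) = truncatedPow a u := by
  simp only [truncatedPow, Set.indicator, abs_neg, Set.mem_Ioo]
  congr 1
  rw [neg_lt_neg_iff, and_comm, neg_lt]

theorem abs_rpow_le_truncatedPow_add {a : ℝ} (ha : a ≤ 0) (u : ℝ) :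
    |u| ^ a ≤ truncatedPow a u + 1 := by
  by_cases hu : u ∈ Set.Ioo (-1 : ℝ) 1
  · simp [truncatedPow, hu]
  · rw [truncatedPow, Set.indicator_of_notMem hu, zero_add]
    refine Real.rpow_le_one_of_one_le_of_nonpos ?_ ha
    rw [le_abs']
    by_contra! h
    exact hu h

theorem integrable_truncatedPow {a : ℝ} (ha : -1 < a) : Integrable (truncatedPow a) := by
  have h1 : IntegrableOn (fun u : ℝ => |u| ^ a) (Set.Ioc 0 1) := by
    have h : IntegrableOn (fun y : ℝ => y ^ a) (Set.Ioc 0 1) := by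
      rw [← intervalIntegrable_iff_integrableOn_Ioc_of_le zero_le_one]
      exact intervalIntegral.intervalIntegrable_rpow' ha
    refine h.congr_fun (fun y hy => ?_) measurableSet_Ioc
    simp only
    rw [abs_of_pos hy.1]
  have h2 : IntegrableOn (fun u : ℝ => |u| ^ a) (Set.Icc (-1) 0) := by
    have h1 := (integrableOn_Icc_iff_integrableOn_Ioc (by simp)).2 h1
    have := h1.comp_neg
    simpa using this
  have : IntegrableOn (fun u : ℝ => |u| ^ a) (Set.Ioo (-1) 1) := by
    refine (h2.union h1).mono_set fun u hu => ?_
    rcases le_or_gt u 0 with h | h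
    · exact Or.inl ⟨hu.1.le, h⟩
    · exact Or.inr ⟨h, hu.2.le⟩
  exact this.integrable_indicator measurableSet_Ioo

theorem abs_sq_sub_sq (t ρ : ℝ) (hρ : 0 ≤ ρ) : |t ^ 2 - ρ ^ 2| = |(|t| - ρ)| * (|t| + ρ) := by
  rw [← sq_abs t, sq_sub_sq, abs_mul, mul_comm, abs_of_nonneg (by positivity : 0 ≤ |t| + ρ)]

/-- A negative power of `|t² - ρ²|` is integrable as long as its exponent exceeds `-1`:
it is at most `ρ^a ||t| - ρ|^a`, whose singularities on the cone and on the axis `ρ = 0` are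
separated. -/
theorem integrable_abs_sq_sub_rpow {a : ℝ} (ha : -1 < a) (ha0 : a ≤ 0) (hd : 1 ≤ d) :
    Integrable fun z : Spacetime d =>
      ((1 + ‖z‖) ^ (d + 3))⁻¹ * |time z ^ 2 - spaceSq z| ^ a := by
  set g : EuclideanSpace ℝ (Fin d) → ℝ := fun x => ‖x‖ ^ a * ((1 + ‖x‖) ^ (d + 1))⁻¹ with hg
  have hgi : Integrable g := integrable_rpow_norm_mul ha ha0 hd
  have hgm : Measurable g := by fun_prop
  have hw : Integrable fun t : ℝ => ((1 + |t|) ^ 2)⁻¹ := by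
    have := integrable_one_add_norm (E := ℝ) (μ := volume) (r := 2) (by simp)
    refine this.congr (Eventually.of_forall fun t => ?_)
    simp only [Real.norm_eq_abs]
    rw [Real.rpow_neg (by positivity)]
    norm_cast
  have hk := integrable_truncatedPow ha
  have hkm := measurable_truncatedPow a
  have i1 := integrable_mul_comp_sub hgi hk hgm hkm (measurable_norm)
  have i2 := integrable_mul_comp_sub (c := fun x => -‖x‖) hgi hk hgm hkm (by fun_prop)
  have i3 := integrable_mul_comp_sub hgi hw hgm (by fun_prop) (measurable_const (a := (0 : ℝ)))
  have hi := (measurePreserving_splitting (d := d)).integrable_comp_of_integrable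
    ((i1.add i2).add i3)
  refine hi.mono' ?_ ?_
  · refine Measurable.aestronglyMeasurable ?_
    have h1 := (continuous_time (d := d)).measurable
    have h2 := (continuous_spaceSq (d := d)).measurable
    fun_prop
  filter_upwards [ae_space_ne_zero hd] with z hz
  have hρ : 0 < ‖space z‖ := norm_pos_iff.2 hz
  rw [Real.norm_of_nonneg (by positivity), ← norm_space_sq, abs_sq_sub_sq _ _ hρ.le,
    Real.mul_rpow (abs_nonneg _) (by positivity)]
  simp only [Function.comp_apply, splitting_apply, Pi.add_apply, sub_neg_eq_add, sub_zero, hg]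
  set t := time z
  set ρ := ‖space z‖
  have e1 : (|t| + ρ) ^ a ≤ ρ ^ a :=
    Real.rpow_le_rpow_of_nonpos hρ (by linarith [abs_nonneg t]) ha0
  have e2 := abs_rpow_le_truncatedPow_add ha0 (|t| - ρ)
  have e3 : truncatedPow a (|t| - ρ) ≤ truncatedPow a (t - ρ) + truncatedPow a (t + ρ) := by
    rcases abs_cases t with ⟨h, -⟩ | ⟨h, -⟩
    · rw [h]
      linarith [truncatedPow_nonneg a (t + ρ)]
    · rw [h, ← truncatedPow_neg a (t + ρ), neg_add, ← sub_eq_add_neg]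
      linarith [truncatedPow_nonneg a (t - ρ)]
  have e4 : ((1 + ‖z‖) ^ (d + 3))⁻¹ ≤ ((1 + ρ) ^ (d + 1))⁻¹ * ((1 + |t|) ^ 2)⁻¹ := by
    rw [← mul_inv]
    have h1 : ρ ≤ ‖z‖ := norm_space_le z
    have h2 : |t| ≤ ‖z‖ := abs_time_le z
    calc ((1 + ‖z‖) ^ (d + 3))⁻¹ = ((1 + ‖z‖) ^ (d + 1) * (1 + ‖z‖) ^ 2)⁻¹ := by
          rw [← pow_add]
      _ ≤ _ := by gcongr
  have e5 : ((1 + |t|) ^ 2)⁻¹ ≤ 1 :=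
    inv_le_one_of_one_le₀ (one_le_pow₀ (by linarith [abs_nonneg t]))
  have p1 := truncatedPow_nonneg a (t - ρ)
  have p2 := truncatedPow_nonneg a (t + ρ)
  calc ((1 + ‖z‖) ^ (d + 3))⁻¹ * (|(|t| - ρ)| ^ a * (|t| + ρ) ^ a)
      ≤ (((1 + ρ) ^ (d + 1))⁻¹ * ((1 + |t|) ^ 2)⁻¹) *
        ((truncatedPow a (t - ρ) + truncatedPow a (t + ρ) + 1) * ρ ^ a) := by
        gcongr
        linarith
    _ = ρ ^ a * ((1 + ρ) ^ (d + 1))⁻¹ * ((truncatedPow a (t - ρ) + truncatedPow a (t + ρ)) *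
          ((1 + |t|) ^ 2)⁻¹ + ((1 + |t|) ^ 2)⁻¹) := by ring
    _ ≤ ρ ^ a * ((1 + ρ) ^ (d + 1))⁻¹ * ((truncatedPow a (t - ρ) + truncatedPow a (t + ρ)) *
          1 + ((1 + |t|) ^ 2)⁻¹) := by gcongr
    _ = _ := by ring

theorem continuous_inv_one_add_norm_pow (N : ℕ) :
    Continuous fun z : Spacetime d => (((1 + ‖z‖) ^ N)⁻¹ : ℝ) :=
  Continuous.inv₀ (by fun_prop) fun z => by positivity

theorem IsTempered.aestronglyMeasurable {K : Spacetime d → ℂ} (hK : IsTempered K) :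
    AEStronglyMeasurable K := by
  obtain ⟨N, hN⟩ := hK
  have h := (Continuous.aestronglyMeasurable (μ := volume)
    (f := fun z : Spacetime d => (1 + ‖z‖) ^ N) (by fun_prop)).smul hN.1
  refine h.congr (Eventually.of_forall fun z => ?_)
  have : (0 : ℝ) < (1 + ‖z‖) ^ N := by positivity
  simp only [Pi.smul_apply', smul_smul]
  rw [mul_inv_cancel₀ this.ne', one_smul]

theorem IsTempered.const_mul {g : Spacetime d → ℂ} (hg : IsTempered g) (c : ℂ) :
    IsTempered fun z => c * g z := by
  obtain ⟨N, hN⟩ := hg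
  refine ⟨N, (hN.const_mul c).congr (Eventually.of_forall fun z => ?_)⟩
  simp only [Complex.real_smul]
  ring

theorem IsTempered.mono {g h : Spacetime d → ℂ} (hg : IsTempered g)
    (hm : AEStronglyMeasurable h) (hle : ∀ᵐ z, ‖h z‖ ≤ ‖g z‖) : IsTempered h := by
  obtain ⟨N, hN⟩ := hg
  refine ⟨N, hN.mono ?_ ?_⟩
  · exact (continuous_inv_one_add_norm_pow _).aestronglyMeasurable.smul hm
  · filter_upwards [hle] with z hz
    rw [norm_smul, norm_smul]
    gcongr

theorem isTempered_of_norm_le {g : Spacetime d → ℂ} (hm : AEStronglyMeasurable g) (C : ℝ) (M : ℕ)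
    (hle : ∀ z, ‖g z‖ ≤ C * (1 + ‖z‖) ^ M) : IsTempered g := by
  refine ⟨M + (d + 2), ?_⟩
  have h := (integrable_one_add_norm (E := Spacetime d) (μ := volume) (r := (d + 2 : ℕ))
    (by simp)).const_mul C
  refine h.mono' ?_ (Eventually.of_forall fun z => ?_)
  · exact (continuous_inv_one_add_norm_pow _).aestronglyMeasurable.smul hm
  · rw [norm_smul, Real.norm_of_nonneg (by positivity), Real.rpow_neg (by positivity),
      Real.rpow_natCast, pow_add, mul_inv]
    have h0 : (0 : ℝ) < (1 + ‖z‖) ^ M := by positivity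
    calc ((1 + ‖z‖) ^ M)⁻¹ * ((1 + ‖z‖) ^ (d + 2))⁻¹ * ‖g z‖
        ≤ ((1 + ‖z‖) ^ M)⁻¹ * ((1 + ‖z‖) ^ (d + 2))⁻¹ * (C * (1 + ‖z‖) ^ M) := by
          gcongr
          exact hle z
      _ = _ := by field_simp

theorem abs_sq_sub_spaceSq_le (z : Spacetime d) : |time z ^ 2 - spaceSq z| ≤ (1 + ‖z‖) ^ 2 := by
  have h := norm_sq_eq z
  rw [← norm_space_sq, abs_le]
  constructor <;> nlinarith [sq_nonneg (time z), sq_nonneg ‖space z‖, norm_nonneg z]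

theorem rpow_le_natCeil_pow {x a : ℝ} (hx : 1 ≤ x) : x ^ a ≤ x ^ ⌈a⌉₊ := by
  rw [← Real.rpow_natCast]
  exact Real.rpow_le_rpow_of_exponent_le hx (Nat.le_ceil a)

theorem isTempered_abs_sq_sub_rpow {a : ℝ} (ha : -1 < a) (hd : 1 ≤ d) :
    IsTempered fun z : Spacetime d => ((|time z ^ 2 - spaceSq z| ^ a : ℝ) : ℂ) := by
  rcases le_total a 0 with h0 | h0
  · refine ⟨d + 3, ?_⟩
    refine (integrable_abs_sq_sub_rpow ha h0 hd).ofReal.congr (Eventually.of_forall fun z => ?_)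
    simp
  · refine isTempered_of_norm_le ?_ 1 (2 * ⌈a⌉₊) fun z => ?_
    · refine Measurable.aestronglyMeasurable ?_
      have h1 := (continuous_time (d := d)).measurable
      have h2 := (continuous_spaceSq (d := d)).measurable
      fun_prop
    · rw [Complex.norm_real, Real.norm_of_nonneg (by positivity), one_mul, pow_mul]
      exact (Real.rpow_le_rpow (abs_nonneg _) (abs_sq_sub_spaceSq_le z) h0).trans
        (rpow_le_natCeil_pow (one_le_pow₀ (by linarith [norm_nonneg z])))

/-! ### The Fourier-Laplace integral of the cone kernel for real `s` -/

section Subordination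

/-- The integrand that results from inserting the subordination formula and the Gaussian
`e^{-|x|²/v}` into the Fourier-Laplace integral of `(t² - |x|²)^a`; the variables are `x`,
`q = t² - |x|²` and the subordination parameter `v`. -/
def subordinated (a : ℂ) (s : ℝ) (ξ : EuclideanSpace ℝ (Fin d))
    (p : (EuclideanSpace ℝ (Fin d) × ℝ) × ℝ) : ℂ :=
  (Complex.exp (-((p.2⁻¹ : ℝ) : ℂ) * ‖p.1.1‖ ^ 2 + (-Complex.I) * (inner ℝ ξ p.1.1 : ℝ)) *
    ((p.1.2 : ℂ) ^ a * Complex.exp (-(p.2⁻¹ * p.1.2 : ℝ)))) *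
    ((p.2 ^ (-(3 / 2) : ℝ) * Real.exp (-(s ^ 2 / 4 * p.2)) : ℝ) : ℂ)

variable {a : ℂ} {s : ℝ} {ξ : EuclideanSpace ℝ (Fin d)}

theorem measurable_subordinated : Measurable (subordinated a s ξ) := by
  unfold subordinated
  fun_prop

theorem integrable_subordinated_left (ha : -1 < a.re) {v : ℝ} (hv : 0 < v) :
    Integrable (fun w => subordinated a s ξ (w, v))
      ((volume : Measure (EuclideanSpace ℝ (Fin d))).prod (volume.restrict (Set.Ioi 0))) := by
  have hb : 0 < (((v⁻¹ : ℝ) : ℂ)).re := by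
    rw [Complex.ofReal_re]
    positivity
  exact Integrable.mul_const
    ((GaussianFourier.integrable_cexp_neg_mul_sq_norm_add hb (-Complex.I) ξ).mul_prod
      (integrableOn_cpow_mul_cexp_neg_mul ha (inv_pos.2 hv)))
    ((v ^ (-(3 / 2) : ℝ) * Real.exp (-(s ^ 2 / 4 * v)) : ℝ) : ℂ)

theorem integral_subordinated_left (ha : -1 < a.re) {v : ℝ} (hv : 0 < v) :
    ∫ w, subordinated a s ξ (w, v)
      ∂((volume : Measure (EuclideanSpace ℝ (Fin d))).prod (volume.restrict (Set.Ioi 0))) =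
    (Real.pi : ℂ) ^ ((d : ℂ) / 2) * Complex.Gamma (a + 1) *
      ((v : ℂ) ^ (a + ((d : ℂ) + 1) / 2 - 1) *
        Complex.exp (-((s ^ 2 + ‖ξ‖ ^ 2) / 4 * v : ℝ))) := by
  have hb : 0 < (((v⁻¹ : ℝ) : ℂ)).re := by
    rw [Complex.ofReal_re]
    positivity
  have hv0 : (v : ℂ) ≠ 0 := by exact_mod_cast hv.ne'
  have h1 := GaussianFourier.integral_cexp_neg_mul_sq_norm_add hb (-Complex.I) ξ
  have h2 := Complex.integral_cpow_mul_exp_neg_mul_Ioi (a := a + 1) (r := v⁻¹)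
    (by simp only [Complex.add_re, Complex.one_re]; linarith) (inv_pos.2 hv)
  have e1 : (Real.pi : ℂ) / ((v⁻¹ : ℝ) : ℂ) = ((Real.pi : ℝ) : ℂ) * (v : ℂ) := by
    push_cast
    field_simp
  have e2 : 1 / ((v⁻¹ : ℝ) : ℂ) = v := by simp
  rw [e2] at h2
  rw [e1, Complex.mul_cpow_ofReal_nonneg Real.pi_pos.le hv.le, finrank_euclideanSpace_fin] at h1
  have h3 : (((v ^ (-(3 / 2) : ℝ) * Real.exp (-(s ^ 2 / 4 * v)) : ℝ)) : ℂ) =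
      (v : ℂ) ^ (-(3 / 2) : ℂ) * Complex.exp (-(s ^ 2 / 4 * v : ℝ)) := by
    push_cast [Complex.ofReal_cpow hv.le]
    rfl
  have h4 : (v : ℂ) ^ (a + ((d : ℂ) + 1) / 2 - 1) =
      (v : ℂ) ^ ((d : ℂ) / 2) * (v : ℂ) ^ (a + 1) * (v : ℂ) ^ (-(3 / 2) : ℂ) := by
    rw [← Complex.cpow_add _ _ hv0, ← Complex.cpow_add _ _ hv0]
    congr 1
    ring
  have h5 : Complex.exp (-((s ^ 2 + ‖ξ‖ ^ 2) / 4 * v : ℝ)) =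
      Complex.exp ((-Complex.I) ^ 2 * ‖ξ‖ ^ 2 / (4 * ((v⁻¹ : ℝ) : ℂ))) *
        Complex.exp (-(s ^ 2 / 4 * v : ℝ)) := by
    rw [← Complex.exp_add]
    congr 1
    rw [neg_sq, Complex.I_sq]
    push_cast
    field_simp
    ring
  unfold subordinated
  simp only
  rw [integral_mul_const, integral_prod_mul (fun x : EuclideanSpace ℝ (Fin d) =>
    Complex.exp (-((v⁻¹ : ℝ) : ℂ) * ‖x‖ ^ 2 + (-Complex.I) * (inner ℝ ξ x : ℝ)))
    (fun q : ℝ => (q : ℂ) ^ a * Complex.exp (-(v⁻¹ * q : ℝ))), h1]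
  simp only [add_sub_cancel_right] at h2
  simp only [Complex.ofReal_mul] at h2 h3 h4 h5 ⊢
  rw [h2, h3, h4, h5]
  push_cast
  ring

/-- The norm of the integrand is the integrand itself for `Re a` and `ξ = 0`, so that the value of
the integral also yields the absolute convergence. -/
theorem norm_subordinated {p : (EuclideanSpace ℝ (Fin d) × ℝ) × ℝ} (hq : 0 < p.1.2)
    (hv : 0 < p.2) :
    ((‖subordinated a s ξ p‖ : ℝ) : ℂ) =
      subordinated (a.re : ℂ) s (0 : EuclideanSpace ℝ (Fin d)) p := by
  unfold subordinated
  rw [norm_mul, norm_mul, norm_mul, Complex.norm_exp, Complex.norm_exp,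
    Complex.norm_cpow_eq_rpow_re_of_pos hq, Complex.norm_real, Real.norm_of_nonneg (by positivity)]
  push_cast [Complex.ofReal_cpow hq.le]
  congr 3
  · simp [← Complex.ofReal_pow, ← Complex.ofReal_inv]
  · simp

theorem integrable_subordinated (hd : 1 ≤ d) (ha : -1 < a.re) (hs : 0 < s) :
    Integrable (subordinated a s ξ)
      (((volume : Measure (EuclideanSpace ℝ (Fin d))).prod (volume.restrict (Set.Ioi 0))).prod
        (volume.restrict (Set.Ioi 0))) := by
  have hre : -1 < (a.re : ℂ).re := ha
  rw [integrable_prod_iff' measurable_subordinated.aestronglyMeasurable]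
  refine ⟨?_, ?_⟩
  · filter_upwards [self_mem_ae_restrict measurableSet_Ioi] with v hv
    exact integrable_subordinated_left ha hv
  · have hd' : (1 : ℝ) ≤ d := by exact_mod_cast hd
    have h := (integrableOn_cpow_mul_cexp_neg_mul (a := (a.re : ℂ) + ((d : ℂ) + 1) / 2 - 1)
      (r := (s ^ 2 + ‖(0 : EuclideanSpace ℝ (Fin d))‖ ^ 2) / 4) (by
        simp
        linarith) (by simp; positivity)).const_mul
      ((Real.pi : ℂ) ^ ((d : ℂ) / 2) * Complex.Gamma (a.re + 1))
    refine Integrable.congr h.norm ?_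
    filter_upwards [self_mem_ae_restrict measurableSet_Ioi] with v hv
    have h1 := integral_subordinated_left (s := s) (ξ := (0 : EuclideanSpace ℝ (Fin d))) hre hv
    rw [← h1, ← Complex.ofReal_inj]
    have h2 : ∫ w, subordinated (a.re : ℂ) s (0 : EuclideanSpace ℝ (Fin d)) (w, v)
        ∂((volume : Measure (EuclideanSpace ℝ (Fin d))).prod (volume.restrict (Set.Ioi 0))) =
        ((∫ w, ‖subordinated a s ξ (w, v)‖
        ∂((volume : Measure (EuclideanSpace ℝ (Fin d))).prod (volume.restrict (Set.Ioi 0))) : ℝ) :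
          ℂ) := by
      rw [← integral_complex_ofReal]
      refine integral_congr_ae ?_
      have : ∀ᵐ w ∂((volume : Measure (EuclideanSpace ℝ (Fin d))).prod
          (volume.restrict (Set.Ioi (0 : ℝ)))), w.2 ∈ Set.Ioi (0 : ℝ) :=
        Measure.quasiMeasurePreserving_snd.ae (self_mem_ae_restrict measurableSet_Ioi)
      filter_upwards [this] with w hw
      exact (norm_subordinated (p := (w, v)) hw hv).symm
    rw [h2, Complex.norm_real, Real.norm_of_nonneg (integral_nonneg fun _ => norm_nonneg _)]

/-- The `v`-integral undoes the subordination, and `q = t² - |x|²`. -/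
theorem integral_subordinated_right (hs : 0 < s) {x : EuclideanSpace ℝ (Fin d)} {q : ℝ}
    (hq : 0 < q) :
    ∫ v in Set.Ioi (0 : ℝ), subordinated a s ξ ((x, q), v) =
      (2 * √Real.pi : ℝ) * (Complex.exp (-Complex.I * (inner ℝ ξ x : ℝ)) *
        ((1 / (2 * √(q + ‖x‖ ^ 2))) • ((q : ℂ) ^ a *
          Complex.exp (-(s * √(q + ‖x‖ ^ 2) : ℝ))))) := by
  have hA : 0 < √(q + ‖x‖ ^ 2) := by positivity
  have hsq : √(q + ‖x‖ ^ 2) ^ 2 = q + ‖x‖ ^ 2 := Real.sq_sqrt (by positivity)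
  have h := integral_subordination hA hs
  have : ∀ v ∈ Set.Ioi (0 : ℝ), subordinated a s ξ ((x, q), v) =
      Complex.exp (-Complex.I * (inner ℝ ξ x : ℝ)) * (q : ℂ) ^ a *
        ((v ^ (-(3 / 2) : ℝ) * Real.exp (-(√(q + ‖x‖ ^ 2) ^ 2 / v) - s ^ 2 * v / 4) : ℝ) : ℂ) := by
    intro v hv
    have hv : (0 : ℝ) < v := hv
    have hv0 : (v : ℂ) ≠ 0 := by exact_mod_cast hv.ne'
    have e : Complex.exp (-((v⁻¹ : ℝ) : ℂ) * ‖x‖ ^ 2 + (-Complex.I) * (inner ℝ ξ x : ℝ)) *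
        (Complex.exp (-(v⁻¹ * q : ℝ)) * Complex.exp (-(s ^ 2 / 4 * v : ℝ))) =
        Complex.exp (-Complex.I * (inner ℝ ξ x : ℝ)) *
          Complex.exp (-(√(q + ‖x‖ ^ 2) ^ 2 / v) - s ^ 2 * v / 4 : ℝ) := by
      rw [← Complex.exp_add, ← Complex.exp_add, ← Complex.exp_add, hsq]
      congr 1
      push_cast
      field_simp
      ring
    unfold subordinated
    simp only [Complex.ofReal_mul, Complex.ofReal_exp] at e ⊢
    push_cast at e ⊢
    linear_combination ((q : ℂ) ^ a * ((v ^ (-(3 / 2) : ℝ) : ℝ) : ℂ)) * e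
  rw [setIntegral_congr_fun measurableSet_Ioi this, integral_const_mul, integral_complex_ofReal, h]
  have hA0 : ((√(q + ‖x‖ ^ 2) : ℝ) : ℂ) ≠ 0 := by exact_mod_cast hA.ne'
  rw [Complex.real_smul]
  push_cast
  field_simp

/-- The Fourier-Laplace integral of `(t² - |x|²)^a` over the forward cone, as an iterated integral,
for real `s`. -/
theorem iterated_integral_cone (hd : 1 ≤ d) (ha : -1 < a.re) (hs : 0 < s) :
    ∫ x : EuclideanSpace ℝ (Fin d), Complex.exp (-Complex.I * (inner ℝ ξ x : ℝ)) *
      ∫ t in Set.Ioi ‖x‖, ((t ^ 2 - ‖x‖ ^ 2 : ℝ) : ℂ) ^ a * Complex.exp (-(s * t : ℝ)) =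
    (2 * √Real.pi : ℝ)⁻¹ * ((Real.pi : ℂ) ^ ((d : ℂ) / 2) * Complex.Gamma (a + 1) *
      (((1 / ((s ^ 2 + ‖ξ‖ ^ 2) / 4 : ℝ)) : ℂ) ^ (a + ((d : ℂ) + 1) / 2) *
        Complex.Gamma (a + ((d : ℂ) + 1) / 2))) := by
  have hd' : (1 : ℝ) ≤ d := by exact_mod_cast hd
  have hI := integrable_subordinated (ξ := ξ) hd ha hs
  -- `h1` integrates in `v` first, `h2` in `v` last
  have h1 := integral_prod _ hI
  have h2 := integral_prod_symm _ hI
  have hG := Complex.integral_cpow_mul_exp_neg_mul_Ioi (a := a + ((d : ℂ) + 1) / 2)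
    (r := ((s ^ 2 + ‖ξ‖ ^ 2) / 4 : ℝ)) (by simp; linarith) (by positivity)
  have h2' : ∫ v in Set.Ioi (0 : ℝ), ∫ w, subordinated a s ξ (w, v)
      ∂((volume : Measure (EuclideanSpace ℝ (Fin d))).prod (volume.restrict (Set.Ioi 0))) =
      (Real.pi : ℂ) ^ ((d : ℂ) / 2) * Complex.Gamma (a + 1) *
      (((1 / ((s ^ 2 + ‖ξ‖ ^ 2) / 4 : ℝ)) : ℂ) ^ (a + ((d : ℂ) + 1) / 2) *
        Complex.Gamma (a + ((d : ℂ) + 1) / 2)) := by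
    rw [setIntegral_congr_fun measurableSet_Ioi
      (fun v hv => integral_subordinated_left (s := s) (ξ := ξ) ha hv), integral_const_mul, ← hG]
    simp only [Complex.ofReal_mul]
  rw [h2, h2', integral_prod _ hI.integral_prod_left] at h1
  rw [h1, ← integral_const_mul]
  refine integral_congr_ae (Eventually.of_forall fun x => ?_)
  simp only
  rw [setIntegral_congr_fun measurableSet_Ioi (fun q hq => integral_subordinated_right
    (a := a) (ξ := ξ) (x := x) hs hq), integral_const_mul, integral_const_mul,
    integral_Ioi_sub_sq_cpow (norm_nonneg x) (fun t => Complex.exp (-(s * t : ℝ)))]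
  have : ((2 * √Real.pi : ℝ) : ℂ) ≠ 0 := by
    have : 0 < 2 * √Real.pi := by positivity
    exact_mod_cast this.ne'
  rw [Complex.ofReal_inv, inv_mul_cancel_left₀ this]

end Subordination

/-! ### Holomorphic parametric integrals and damping on the cone -/

/-- Holomorphy of parametric integrals: by Cauchy's estimate a bound on the integrand alone
is enough. -/
theorem differentiableAt_integral_of_dominated {X : Type*} [MeasurableSpace X] {μ : Measure X}
    {F : ℂ → X → ℂ} {s₀ : ℂ} {r : ℝ} (hr : 0 < r) {bound : X → ℝ}
    (hm : ∀ s ∈ Metric.ball s₀ r, AEStronglyMeasurable (F s) μ)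
    (hd : ∀ᵐ x ∂μ, DifferentiableOn ℂ (fun s => F s x) (Metric.ball s₀ r))
    (hb : ∀ᵐ x ∂μ, ∀ s ∈ Metric.ball s₀ r, ‖F s x‖ ≤ bound x) (hi : Integrable bound μ) :
    DifferentiableAt ℂ (fun s => ∫ x, F s x ∂μ) s₀ := by
  have hmem : s₀ ∈ Metric.ball s₀ r := Metric.mem_ball_self hr
  have hsub : Metric.ball s₀ (r / 2) ⊆ Metric.ball s₀ r := Metric.ball_subset_ball (by linarith)
  refine (hasDerivAt_integral_of_dominated_loc_of_deriv_le (𝕜 := ℂ) (F := F)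
    (F' := fun s x => deriv (fun s => F s x) s) (bound := fun x => bound x / (r / 4))
    (Metric.ball_mem_nhds s₀ (half_pos hr)) ?_ ?_ ?_ ?_ (hi.div_const _) ?_).2.differentiableAt
  · filter_upwards [Metric.ball_mem_nhds s₀ hr] with s hs using hm s hs
  · exact hi.mono' (hm _ hmem) (hb.mono fun x hx => hx _ hmem)
  · -- the derivative is an almost everywhere limit of difference quotients
    set h : ℕ → ℂ := fun n => ((r / (n + 2) : ℝ) : ℂ) with hh
    have hpos : ∀ n : ℕ, 0 < r / (n + 2 : ℝ) := fun n => by positivity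
    have hball : ∀ n, s₀ + h n ∈ Metric.ball s₀ r := fun n => by
      rw [Metric.mem_ball, dist_eq_norm, add_sub_cancel_left, hh, Complex.norm_real,
        Real.norm_of_nonneg (hpos n).le, div_lt_iff₀ (by positivity)]
      nlinarith [(Nat.cast_nonneg n : (0 : ℝ) ≤ n)]
    have hlim : Tendsto h atTop (𝓝[≠] 0) := by
      refine tendsto_nhdsWithin_iff.2 ⟨?_, Eventually.of_forall fun n => ?_⟩
      · have : Tendsto (fun n : ℕ => r / ((n : ℝ) + 2)) atTop (𝓝 0) :=
          tendsto_const_nhds.div_atTop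
            (tendsto_atTop_add_const_right _ _ tendsto_natCast_atTop_atTop)
        have := (Complex.continuous_ofReal.tendsto 0).comp this
        rwa [Complex.ofReal_zero] at this
      · exact Complex.ofReal_ne_zero.2 (hpos n).ne'
    refine aestronglyMeasurable_of_tendsto_ae atTop
      (f := fun n x => (h n)⁻¹ • (F (s₀ + h n) x - F s₀ x))
      (fun n => ((hm _ (hball n)).sub (hm _ hmem)).const_smul (h n)⁻¹) ?_
    filter_upwards [hd] with x hx
    exact (hasDerivAt_iff_tendsto_slope_zero.1
      (hx.differentiableAt (Metric.ball_mem_nhds s₀ hr)).hasDerivAt).comp hlim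
  · filter_upwards [hd, hb] with x hx hbx s hs
    have hsub' : Metric.closedBall s (r / 4) ⊆ Metric.ball s₀ r := by
      intro z hz
      have h1 := Metric.mem_closedBall.1 hz
      have h2 := Metric.mem_ball.1 hs
      rw [Metric.mem_ball]
      linarith [dist_triangle z s s₀]
    refine Complex.norm_deriv_le_of_forall_mem_sphere_norm_le (by positivity) ?_
      fun z hz => hbx z (hsub' (Metric.sphere_subset_closedBall hz))
    refine (hx.mono ?_).diffContOnCl
    rw [closure_ball _ (by positivity)]
    exact hsub'
  · filter_upwards [hd] with x hx s hs
    exact (hx.differentiableAt (Metric.isOpen_ball.mem_nhds (hsub hs))).hasDerivAt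

theorem measurableSet_causalCone : MeasurableSet (causalCone d) := by
  refine IsClosed.measurableSet ?_
  exact (isClosed_le continuous_spaceSq (by fun_prop)).inter
    (isClosed_le continuous_const continuous_time)

theorem norm_le_of_mem_causalCone {z : Spacetime d} (hz : z ∈ causalCone d) :
    ‖z‖ ≤ 2 * time z := by
  have h := norm_sq_eq z
  rw [norm_space_sq] at h
  refine le_of_sq_le_sq ?_ (by linarith [hz.2])
  nlinarith [hz.1, sq_nonneg (time z)]

theorem exists_one_add_pow_mul_exp_le (N : ℕ) {ε : ℝ} (hε : 0 < ε) :
    ∃ C : ℝ, 0 ≤ C ∧ ∀ t : ℝ, 0 ≤ t → (1 + 2 * t) ^ N * Real.exp (-(ε * t)) ≤ C := by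
  refine ⟨N.factorial * Real.exp (ε / 2) * (2 / ε) ^ N, by positivity, fun t ht => ?_⟩
  have h := Real.pow_div_factorial_le_exp (x := ε / 2 * (1 + 2 * t)) (by positivity) N
  rw [div_le_iff₀ (by positivity), mul_pow] at h
  have e1 : Real.exp (ε / 2 * (1 + 2 * t)) = Real.exp (ε / 2) * Real.exp (ε * t) := by
    rw [← Real.exp_add]
    congr 1
    ring
  have e2 : (2 / ε) ^ N * (ε / 2) ^ N = 1 := by
    rw [← mul_pow]
    field_simp
    simp
  have e3 : Real.exp (ε * t) * Real.exp (-(ε * t)) = 1 := by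
    rw [← Real.exp_add]
    simp
  rw [e1] at h
  calc (1 + 2 * t) ^ N * Real.exp (-(ε * t))
      = (2 / ε) ^ N * ((ε / 2) ^ N * (1 + 2 * t) ^ N) * Real.exp (-(ε * t)) := by
        rw [← mul_assoc, e2, one_mul]
    _ ≤ (2 / ε) ^ N * (Real.exp (ε / 2) * Real.exp (ε * t) * N.factorial) *
        Real.exp (-(ε * t)) := by gcongr
    _ = (2 / ε) ^ N * Real.exp (ε / 2) * N.factorial *
        (Real.exp (ε * t) * Real.exp (-(ε * t))) := by ring
    _ = _ := by rw [e3]; ring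

/-- On the forward cone `e^{-εt}` decays faster than any power of `|z|`. -/
theorem IsTempered.integrable_mul_cexp {g : Spacetime d → ℂ} (hg : IsTempered g)
    (hsupp : ∀ z, z ∉ causalCone d → g z = 0) {s : ℂ} (hs : 0 < s.re) :
    Integrable fun z => g z * Complex.exp (-(s * time z)) := by
  have hgm := hg.aestronglyMeasurable
  obtain ⟨N, hN⟩ := hg
  obtain ⟨C, hC0, hC⟩ := exists_one_add_pow_mul_exp_le N hs
  refine (hN.norm.const_mul C).mono' (hgm.mul (Continuous.aestronglyMeasurable (by fun_prop)))
    (Eventually.of_forall fun z => ?_)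
  by_cases hz : z ∈ causalCone d
  · have hle := norm_le_of_mem_causalCone hz
    have h0 : (0 : ℝ) < (1 + ‖z‖) ^ N := by positivity
    have h1 := hC _ hz.2
    have h2 : (1 + ‖z‖) ^ N ≤ (1 + 2 * time z) ^ N := by gcongr
    rw [norm_mul, norm_smul, Real.norm_of_nonneg (by positivity), Complex.norm_exp]
    have e : (-(s * time z)).re = -(s.re * time z) := by simp
    rw [e]
    calc ‖g z‖ * Real.exp (-(s.re * time z))
        = ((1 + ‖z‖) ^ N * Real.exp (-(s.re * time z))) * (((1 + ‖z‖) ^ N)⁻¹ * ‖g z‖) := by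
          field_simp
      _ ≤ ((1 + 2 * time z) ^ N * Real.exp (-(s.re * time z))) *
          (((1 + ‖z‖) ^ N)⁻¹ * ‖g z‖) := by gcongr
      _ ≤ _ := by gcongr
  · rw [hsupp z hz]
    simp

/-- The function `(t² - |x|²)^a` on the forward cone, extended by zero. -/
def coneKernel (d : ℕ) (a : ℂ) : Spacetime d → ℂ :=
  (causalCone d).indicator fun z => ((time z ^ 2 - spaceSq z : ℝ) : ℂ) ^ a

theorem measurable_coneKernel (a : ℂ) : Measurable (coneKernel d a) := by
  have h1 := (continuous_time (d := d)).measurable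
  have h2 := (continuous_spaceSq (d := d)).measurable
  exact Measurable.indicator (by fun_prop) measurableSet_causalCone

theorem coneKernel_of_notMem (a : ℂ) {z : Spacetime d} (hz : z ∉ causalCone d) :
    coneKernel d a z = 0 :=
  Set.indicator_of_notMem hz _

theorem norm_ofReal_cpow_le_of_nonneg {x : ℝ} (hx : 0 ≤ x) (a : ℂ) :
    ‖(x : ℂ) ^ a‖ ≤ |x| ^ a.re := by
  rcases hx.eq_or_lt with rfl | h
  · rcases eq_or_ne a 0 with rfl | h0
    · simp
    · rw [Complex.ofReal_zero, Complex.zero_cpow h0, norm_zero]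
      positivity
  · rw [Complex.norm_cpow_eq_rpow_re_of_pos h, abs_of_pos h]

theorem ae_sq_ne_spaceSq : ∀ᵐ z : Spacetime d, time z ^ 2 ≠ spaceSq z := by
  have h : ∀ᵐ p : ℝ × EuclideanSpace ℝ (Fin d), p.1 ^ 2 ≠ ‖p.2‖ ^ 2 := by
    have h' : ∀ᵐ p : EuclideanSpace ℝ (Fin d) × ℝ, p.2 ^ 2 ≠ ‖p.1‖ ^ 2 := by
      refine (Measure.ae_prod_iff_ae_ae (MeasurableSet.compl
        (measurableSet_eq_fun (by fun_prop) (by fun_prop)))).2 ?_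
      refine Eventually.of_forall fun x => ?_
      have : ({‖x‖, -‖x‖} : Set ℝ).Finite := Set.toFinite _
      filter_upwards [this.measure_zero volume |> compl_mem_ae_iff.2] with t ht h
      exact ht (sq_eq_sq_iff_eq_or_eq_neg.1 h)
    exact Measure.measurePreserving_swap.quasiMeasurePreserving.ae h'
  filter_upwards [measurePreserving_splitting.quasiMeasurePreserving.ae h] with z hz
  rw [← norm_space_sq]
  exact hz

theorem isTempered_coneKernel (hd : 1 ≤ d) {a : ℂ} (ha : -1 < a.re) :
    IsTempered (coneKernel d a) := by
  refine (isTempered_abs_sq_sub_rpow ha hd).mono (measurable_coneKernel a).aestronglyMeasurable ?_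
  refine Eventually.of_forall fun z => ?_
  rw [Complex.norm_real, Real.norm_of_nonneg (by positivity)]
  by_cases h : z ∈ causalCone d
  · rw [coneKernel, Set.indicator_of_mem h]
    exact norm_ofReal_cpow_le_of_nonneg (sub_nonneg.2 h.1) a
  · rw [coneKernel_of_notMem a h, norm_zero]
    positivity

/-! ### The Fourier-Laplace transform of the Riesz kernel -/

section Laplace

variable {a : ℂ} {ξ : EuclideanSpace ℝ (Fin d)}

theorem integrable_cone_laplace (hd : 1 ≤ d) (ha : -1 < a.re) {s : ℂ} (hs : 0 < s.re) :
    Integrable fun z : Spacetime d => coneKernel d a z * Complex.exp (-(s * time z)) *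
      Complex.exp (-Complex.I * (inner ℝ ξ (space z) : ℝ)) := by
  refine ((isTempered_coneKernel hd ha).integrable_mul_cexp
    (fun z hz => coneKernel_of_notMem a hz) hs).mul_bdd (c := 1)
    (Continuous.aestronglyMeasurable (by fun_prop)) (Eventually.of_forall fun z => ?_)
  rw [Complex.norm_exp]
  simp

theorem mem_causalCone_iff (z : Spacetime d) : z ∈ causalCone d ↔ ‖space z‖ ≤ time z := by
  rw [causalCone, Set.mem_ofPred_eq, ← norm_space_sq]
  exact ⟨fun h => le_of_sq_le_sq h.1 h.2, fun h =>
    ⟨pow_le_pow_left₀ (norm_nonneg _) h 2, (norm_nonneg _).trans h⟩⟩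

theorem integral_cone_laplace_ofReal (hd : 1 ≤ d) (ha : -1 < a.re) {s : ℝ} (hs : 0 < s) :
    ∫ z : Spacetime d, coneKernel d a z * Complex.exp (-((s : ℂ) * time z)) *
      Complex.exp (-Complex.I * (inner ℝ ξ (space z) : ℝ)) =
    (2 * √Real.pi : ℝ)⁻¹ * ((Real.pi : ℂ) ^ ((d : ℂ) / 2) * Complex.Gamma (a + 1) *
      (((1 / ((s ^ 2 + ‖ξ‖ ^ 2) / 4 : ℝ)) : ℂ) ^ (a + ((d : ℂ) + 1) / 2) *
        Complex.Gamma (a + ((d : ℂ) + 1) / 2))) := by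
  have hmp := (measurePreserving_splitting (d := d)).symm
  have hi := integrable_cone_laplace (ξ := ξ) hd ha (s := s) (by simpa using hs)
  rw [← hmp.integral_comp', ← iterated_integral_cone hd ha hs]
  rw [Measure.volume_eq_prod]
  refine (integral_prod_symm _
    ((hmp.integrable_comp_emb (splitting d).symm.measurableEmbedding).2 hi)).trans ?_
  refine integral_congr_ae (Eventually.of_forall fun x => ?_)
  simp only [Function.comp_apply]
  rw [← integral_const_mul, ← integral_Ici_eq_integral_Ioi, ← integral_indicator measurableSet_Ici]
  refine integral_congr_ae (Eventually.of_forall fun t => ?_)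
  obtain ⟨ht, hx⟩ : time ((splitting d).symm (t, x)) = t ∧
      space ((splitting d).symm (t, x)) = x := by
    have := (splitting d).apply_symm_apply (t, x)
    rw [splitting_apply] at this
    exact ⟨congrArg Prod.fst this, congrArg Prod.snd this⟩
  have hmem := mem_causalCone_iff ((splitting d).symm (t, x))
  rw [ht, hx] at hmem
  simp only [ht, hx]
  by_cases h : ‖x‖ ≤ t
  · rw [coneKernel, Set.indicator_of_mem (hmem.2 h), Set.indicator_of_mem (Set.mem_Ici.2 h),
      ht, ← norm_space_sq, hx, Complex.ofReal_mul]
    ring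
  · rw [coneKernel_of_notMem _ (fun h' => h (hmem.1 h')),
      Set.indicator_of_notMem (by simpa using h)]
    simp

theorem normSq_add_sq_mem_slitPlane (r : ℝ) {s : ℂ} (hs : 0 < s.re) :
    (r : ℂ) ^ 2 + s ^ 2 ∈ Complex.slitPlane := by
  rw [Complex.mem_slitPlane_iff]
  by_cases h : s.im = 0
  · left
    have : 0 < s.re ^ 2 := by positivity
    simp [pow_two, h]
    nlinarith [sq_nonneg r]
  · right
    have e : ((r : ℂ) ^ 2 + s ^ 2).im = 2 * s.re * s.im := by
      simp [pow_two]
      ring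
    rw [e]
    exact mul_ne_zero (by positivity) h

/-- The value of the Fourier-Laplace integral of `(t² - |x|²)^a`, from real `s` by the identity
theorem. -/
theorem integral_cone_laplace (hd : 1 ≤ d) (ha : -1 < a.re) {s : ℂ} (hs : 0 < s.re) :
    rieszConst d (a + ((d : ℂ) + 1) / 2) *
    ∫ z : Spacetime d, coneKernel d a z * Complex.exp (-(s * time z)) *
      Complex.exp (-Complex.I * (inner ℝ ξ (space z) : ℝ)) =
    ((‖ξ‖ : ℂ) ^ 2 + s ^ 2) ^ (-(a + ((d : ℂ) + 1) / 2)) := by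
  have hd' : (1 : ℝ) ≤ d := by exact_mod_cast hd
  set α := a + ((d : ℂ) + 1) / 2 with hα
  have hαre : 0 < α.re := by
    simp [hα]
    linarith
  set U : Set ℂ := {s | 0 < s.re} with hU
  have hUo : IsOpen U := isOpen_lt continuous_const Complex.continuous_re
  have hf : DifferentiableOn ℂ (fun s : ℂ => rieszConst d α *
      ∫ z : Spacetime d, coneKernel d a z * Complex.exp (-(s * time z)) *
        Complex.exp (-Complex.I * (inner ℝ ξ (space z) : ℝ))) U := by
    intro s₀ hs₀
    have hs₀ : 0 < s₀.re := hs₀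
    have hball : ∀ s ∈ Metric.ball s₀ (s₀.re / 2), s₀.re / 2 ≤ s.re := fun s hs => by
      have h1 := Metric.mem_ball.1 hs
      have h2 := Complex.abs_re_le_norm (s - s₀)
      rw [dist_eq_norm] at h1
      rw [Complex.sub_re] at h2
      have := (abs_le.1 h2).1
      linarith
    refine DifferentiableAt.differentiableWithinAt (DifferentiableAt.const_mul ?_ _)
    refine differentiableAt_integral_of_dominated (half_pos hs₀)
      (fun s hs => (integrable_cone_laplace hd ha
        (lt_of_lt_of_le (half_pos hs₀) (hball s hs))).aestronglyMeasurable)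
      (Eventually.of_forall fun z => ?_) (Eventually.of_forall fun z s hs => ?_)
      (integrable_cone_laplace (ξ := ξ) hd ha (s := (s₀.re / 2 : ℝ)) (by
        rw [Complex.ofReal_re]
        exact half_pos hs₀)).norm
    · refine Differentiable.differentiableOn ?_
      fun_prop
    · by_cases hz : z ∈ causalCone d
      · rw [norm_mul, norm_mul, norm_mul, norm_mul]
        gcongr
        rw [Complex.norm_exp, Complex.norm_exp]
        simp only [Complex.neg_re, Complex.re_mul_ofReal, Complex.ofReal_re]
        have := mul_le_mul_of_nonneg_right (hball s hs) hz.2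
        gcongr
      · rw [coneKernel_of_notMem a hz]
        simp
  have hg : DifferentiableOn ℂ (fun s : ℂ => ((‖ξ‖ : ℂ) ^ 2 + s ^ 2) ^ (-α)) U := fun s hs =>
    DifferentiableAt.differentiableWithinAt (DifferentiableAt.cpow_const
      (by fun_prop) (by simpa using normSq_add_sq_mem_slitPlane ‖ξ‖ hs))
  have hpre : IsPreconnected U := (convex_halfSpace_re_gt 0).isPreconnected
  refine (hf.analyticOnNhd hUo).eqOn_of_preconnected_of_frequently_eq
    (hg.analyticOnNhd hUo) hpre (z₀ := 1) (by simp [hU]) ?_ hs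
  -- on the positive axis both sides are explicit
  have hreal : ∀ r : ℝ, 0 < r → rieszConst d α *
      ∫ z : Spacetime d, coneKernel d a z * Complex.exp (-((r : ℂ) * time z)) *
        Complex.exp (-Complex.I * (inner ℝ ξ (space z) : ℝ)) =
      ((‖ξ‖ : ℂ) ^ 2 + (r : ℂ) ^ 2) ^ (-α) := by
    intro r hr
    rw [integral_cone_laplace_ofReal hd ha hr, ← hα]
    have hG1 : Complex.Gamma α ≠ 0 := Complex.Gamma_ne_zero_of_re_pos hαre
    have hG2 : Complex.Gamma (a + 1) ≠ 0 := Complex.Gamma_ne_zero_of_re_pos (by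
      rw [Complex.add_re, Complex.one_re]
      linarith)
    have hR : 0 < r ^ 2 + ‖ξ‖ ^ 2 := by positivity
    have e1 : α + 1 - ((d : ℂ) + 1) / 2 = a + 1 := by rw [hα]; ring
    have hpi : (Real.pi : ℂ) ≠ 0 := by exact_mod_cast Real.pi_ne_zero
    have e2 : ((√Real.pi : ℝ) : ℂ) = (Real.pi : ℂ) ^ (1 / 2 : ℂ) := by
      rw [Real.sqrt_eq_rpow, Complex.ofReal_cpow Real.pi_pos.le]
      norm_num
    have e3 : (Real.pi : ℂ) ^ (1 - ((d : ℂ) + 1) / 2) * (Real.pi : ℂ) ^ ((d : ℂ) / 2) =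
        (Real.pi : ℂ) ^ (1 / 2 : ℂ) := by
      rw [← Complex.cpow_add _ _ hpi]
      congr 1
      ring
    have e4 : (1 / ((r ^ 2 + ‖ξ‖ ^ 2) / 4 : ℝ) : ℂ) ^ α =
        (2 : ℂ) ^ (2 * α) * (((r ^ 2 + ‖ξ‖ ^ 2 : ℝ)) : ℂ) ^ (-α) := by
      have h1 : (1 / ((r ^ 2 + ‖ξ‖ ^ 2) / 4 : ℝ) : ℂ) =
          ((4 : ℝ) : ℂ) * (((r ^ 2 + ‖ξ‖ ^ 2)⁻¹ : ℝ) : ℂ) := by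
        push_cast
        field_simp
      rw [h1, Complex.mul_cpow_ofReal_nonneg (by norm_num) (by positivity), Complex.ofReal_inv,
        Complex.inv_cpow _ _ (by
          rw [Complex.arg_ofReal_of_nonneg hR.le]
          exact Real.pi_pos.ne), Complex.cpow_neg]
      congr 1
      have h2 := Complex.natCast_mul_natCast_cpow 2 2 α
      rw [two_mul, Complex.cpow_add _ _ two_ne_zero]
      norm_num at h2 ⊢
      exact h2
    have e5 : (2 : ℂ) ^ (1 - 2 * α) * (2 : ℂ) ^ (2 * α) = 2 := by
      rw [← Complex.cpow_add _ _ two_ne_zero]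
      simp
    have e6 : (‖ξ‖ : ℂ) ^ 2 + (r : ℂ) ^ 2 = ((r ^ 2 + ‖ξ‖ ^ 2 : ℝ) : ℂ) := by
      push_cast
      ring
    have hsq : (Real.pi : ℂ) ^ (1 / 2 : ℂ) ≠ 0 := by
      rw [Ne, Complex.cpow_eq_zero_iff]
      exact fun h => hpi h.1
    rw [rieszConst, e1, e4, e6]
    push_cast
    rw [e2]
    generalize (Real.pi : ℂ) ^ (1 - ((d : ℂ) + 1) / 2) = A at e3 ⊢
    generalize (Real.pi : ℂ) ^ ((d : ℂ) / 2) = B at e3 ⊢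
    generalize (2 : ℂ) ^ (1 - 2 * α) = C at e5 ⊢
    field_simp
    linear_combination A * B * ((r : ℂ) ^ 2 + (‖ξ‖ : ℂ) ^ 2) ^ (-α) * e5 + 2 *
      ((r : ℂ) ^ 2 + (‖ξ‖ : ℂ) ^ 2) ^ (-α) * e3
  have hu : Tendsto (fun n : ℕ => ((1 + 1 / ((n : ℝ) + 1) : ℝ) : ℂ)) atTop (𝓝[≠] 1) := by
    refine tendsto_nhdsWithin_iff.2 ⟨?_, Eventually.of_forall fun n => ?_⟩
    · have h := (tendsto_one_div_add_atTop_nhds_zero_nat (𝕜 := ℝ)).const_add 1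
      have := (Complex.continuous_ofReal.tendsto _).comp h
      rwa [add_zero, Complex.ofReal_one] at this
    · have : (0 : ℝ) < 1 / ((n : ℝ) + 1) := by positivity
      rw [Set.mem_compl_singleton_iff, ← Complex.ofReal_one, Ne, Complex.ofReal_inj]
      linarith
  exact hu.frequently (Frequently.of_forall fun n => hreal _ (by positivity))

end Laplace

theorem regSymbol_base_eq (ε : ℝ) (ζ : Spacetime d) :
    (spaceSq ζ : ℂ) - ((time ζ : ℂ) - Complex.I * ε) ^ 2 =
      (‖space ζ‖ : ℂ) ^ 2 + ((ε : ℂ) + Complex.I * time ζ) ^ 2 := by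
  rw [← norm_space_sq]
  push_cast
  linear_combination (-(ε : ℂ) ^ 2 - (time ζ : ℂ) ^ 2) * Complex.I_sq

theorem rieszKernel_eq (α : ℂ) (z : Spacetime d) :
    rieszKernel d α z = rieszConst d α * coneKernel d (α - ((d : ℂ) + 1) / 2) z := by
  by_cases hz : z ∈ causalCone d
  · rw [rieszKernel, coneKernel, Set.indicator_of_mem hz, Set.indicator_of_mem hz]
  · rw [rieszKernel, coneKernel, Set.indicator_of_notMem hz, Set.indicator_of_notMem hz, mul_zero]

theorem rieszKernel_of_notMem (α : ℂ) {z : Spacetime d} (hz : z ∉ causalCone d) :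
    rieszKernel d α z = 0 :=
  Set.indicator_of_notMem hz _

theorem measurable_rieszKernel (α : ℂ) : Measurable (rieszKernel d α) := by
  simp only [funext (rieszKernel_eq (d := d) α)]
  exact (measurable_coneKernel _).const_mul _

theorem neg_one_lt_re {α : ℂ} (hα : ((d : ℝ) + 1) / 2 - 1 < α.re) :
    -1 < (α - ((d : ℂ) + 1) / 2).re := by
  simp
  linarith

theorem isTempered_rieszKernel (hd : 1 ≤ d) {α : ℂ} (hα : ((d : ℝ) + 1) / 2 - 1 < α.re) :
    IsTempered (rieszKernel d α) := by
  rw [funext (rieszKernel_eq (d := d) α)]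
  exact (isTempered_coneKernel hd (neg_one_lt_re hα)).const_mul _

/-- The Fourier transform of `e^{-εt} R_α` is `(|ξ|² - (τ - iε)²)^{-α}`. -/
theorem integral_rieszKernel_mul_cexp (hd : 1 ≤ d) {α : ℂ} (hα : ((d : ℝ) + 1) / 2 - 1 < α.re)
    {ε : ℝ} (hε : 0 < ε) (ζ : Spacetime d) :
    ∫ z, Complex.exp (-(Complex.I * (inner ℝ z ζ : ℝ))) *
      (rieszKernel d α z * Complex.exp (-((ε : ℂ) * time z))) = regSymbol d ε (-α) ζ := by
  have h := integral_cone_laplace (ξ := space ζ) hd (neg_one_lt_re hα)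
    (s := (ε : ℂ) + Complex.I * time ζ) (by simpa using hε)
  rw [sub_add_cancel] at h
  rw [regSymbol, regSymbol_base_eq, ← h, ← integral_const_mul]
  refine integral_congr_ae (Eventually.of_forall fun z => ?_)
  simp only
  rw [rieszKernel_eq, inner_eq, real_inner_comm (space ζ) (space z)]
  have e : Complex.exp (-(Complex.I *
        ((time z * time ζ + inner ℝ (space ζ) (space z) : ℝ) : ℂ))) *
      Complex.exp (-((ε : ℂ) * time z)) =
      Complex.exp (-(((ε : ℂ) + Complex.I * time ζ) * time z)) *
        Complex.exp (-Complex.I * (inner ℝ (space ζ) (space z) : ℝ)) := by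
    rw [← Complex.exp_add, ← Complex.exp_add]
    congr 1
    push_cast
    ring
  linear_combination (rieszConst d α * coneKernel d (α - ((d : ℂ) + 1) / 2) z) * e

/-! ### The regularized symbol and the wave operator on Schwartz functions -/

theorem regSymbol_base_mem_slitPlane {ε : ℝ} (hε : 0 < ε) (ζ : Spacetime d) :
    (spaceSq ζ : ℂ) - ((time ζ : ℂ) - Complex.I * ε) ^ 2 ∈ Complex.slitPlane := by
  rw [regSymbol_base_eq]
  exact normSq_add_sq_mem_slitPlane ‖space ζ‖ (by simpa using hε)

theorem continuous_regSymbol {ε : ℝ} (hε : 0 < ε) (β : ℂ) : Continuous (regSymbol d ε β) :=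
  Continuous.cpow (by fun_prop) continuous_const fun ζ => regSymbol_base_mem_slitPlane hε ζ

theorem norm_cpow_le_rpow_mul {z : ℂ} (hz : z ≠ 0) (β : ℂ) :
    ‖z ^ β‖ ≤ ‖z‖ ^ β.re * Real.exp (Real.pi * |β.im|) := by
  rw [Complex.norm_cpow_of_ne_zero hz, div_eq_mul_inv, ← Real.exp_neg]
  gcongr
  calc -(z.arg * β.im) ≤ |z.arg * β.im| := neg_le_abs _
    _ = |z.arg| * |β.im| := abs_mul _ _
    _ ≤ _ := by
      gcongr
      exact Complex.abs_arg_le_pi z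

theorem regSymbol_base_eq_mul (ε : ℝ) (ζ : Spacetime d) :
    (spaceSq ζ : ℂ) - ((time ζ : ℂ) - Complex.I * ε) ^ 2 =
      ((‖space ζ‖ - time ζ : ℝ) + Complex.I * ε) * ((‖space ζ‖ + time ζ : ℝ) - Complex.I * ε) := by
  rw [← norm_space_sq]
  push_cast
  ring

/-- The regularization moves the base of the power away from zero, so that for negative exponents
the limit `ε → 0` is dominated by the limit function. -/
theorem abs_le_norm_regSymbol_base (ε : ℝ) (ζ : Spacetime d) :
    |time ζ ^ 2 - spaceSq ζ| ≤ ‖(spaceSq ζ : ℂ) - ((time ζ : ℂ) - Complex.I * ε) ^ 2‖ := by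
  have h1 := Complex.abs_re_le_norm (((‖space ζ‖ - time ζ : ℝ) : ℂ) + Complex.I * ε)
  have h2 := Complex.abs_re_le_norm (((‖space ζ‖ + time ζ : ℝ) : ℂ) - Complex.I * ε)
  rw [regSymbol_base_eq_mul, norm_mul, ← norm_space_sq, abs_sub_comm, sq_sub_sq, abs_mul,
    mul_comm |‖space ζ‖ + time ζ|]
  gcongr
  · simpa using h1
  · simpa using h2

theorem sq_le_norm_regSymbol_base {ε : ℝ} (hε : 0 < ε) (ζ : Spacetime d) :
    ε ^ 2 ≤ ‖(spaceSq ζ : ℂ) - ((time ζ : ℂ) - Complex.I * ε) ^ 2‖ := by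
  have h1 := Complex.abs_im_le_norm (((‖space ζ‖ - time ζ : ℝ) : ℂ) + Complex.I * ε)
  have h2 := Complex.abs_im_le_norm (((‖space ζ‖ + time ζ : ℝ) : ℂ) - Complex.I * ε)
  rw [regSymbol_base_eq_mul, norm_mul, pow_two]
  gcongr
  · simpa [abs_of_pos hε] using h1
  · simpa [abs_of_pos hε] using h2

theorem norm_regSymbol_base_le {ε : ℝ} (hε : 0 ≤ ε) (ζ : Spacetime d) :
    ‖(spaceSq ζ : ℂ) - ((time ζ : ℂ) - Complex.I * ε) ^ 2‖ ≤ ((1 + ε) * (1 + ‖ζ‖)) ^ 2 := by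
  have h1 : ‖(spaceSq ζ : ℂ)‖ = ‖space ζ‖ ^ 2 := by
    rw [Complex.norm_real, ← norm_space_sq, Real.norm_of_nonneg (by positivity)]
  have h2 : ‖(time ζ : ℂ) - Complex.I * ε‖ ≤ |time ζ| + ε := by
    refine (norm_sub_le _ _).trans ?_
    simp [abs_of_nonneg hε]
  have h3 := norm_sq_eq ζ
  have h4 := abs_time_le ζ
  calc ‖(spaceSq ζ : ℂ) - ((time ζ : ℂ) - Complex.I * ε) ^ 2‖
      ≤ ‖space ζ‖ ^ 2 + (|time ζ| + ε) ^ 2 := by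
        refine (norm_sub_le _ _).trans ?_
        rw [h1, norm_pow]
        gcongr
    _ ≤ (‖ζ‖ + ε) ^ 2 := by nlinarith [sq_abs (time ζ)]
    _ ≤ _ := by
        have := norm_nonneg ζ
        gcongr
        nlinarith

theorem norm_regSymbol_le_of_nonneg {ε : ℝ} (hε : 0 < ε) {β : ℂ} (hβ : 0 ≤ β.re)
    (ζ : Spacetime d) :
    ‖regSymbol d ε β ζ‖ ≤ (1 + ε) ^ (2 * ⌈β.re⌉₊) * Real.exp (Real.pi * |β.im|) *
      (1 + ‖ζ‖) ^ (2 * ⌈β.re⌉₊) := by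
  have h1 := norm_regSymbol_base_le hε.le ζ
  have h2 : 1 ≤ ((1 + ε) * (1 + ‖ζ‖)) ^ 2 :=
    one_le_pow₀ (by nlinarith [norm_nonneg ζ, mul_nonneg hε.le (norm_nonneg ζ)])
  calc ‖regSymbol d ε β ζ‖
      ≤ ‖(spaceSq ζ : ℂ) - ((time ζ : ℂ) - Complex.I * ε) ^ 2‖ ^ β.re *
        Real.exp (Real.pi * |β.im|) :=
        norm_cpow_le_rpow_mul (Complex.slitPlane_ne_zero (regSymbol_base_mem_slitPlane hε ζ)) β
    _ ≤ (((1 + ε) * (1 + ‖ζ‖)) ^ 2) ^ ⌈β.re⌉₊ * Real.exp (Real.pi * |β.im|) := by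
        gcongr
        exact (Real.rpow_le_rpow (norm_nonneg _) h1 hβ).trans (rpow_le_natCeil_pow h2)
    _ = _ := by
        rw [← pow_mul, mul_pow]
        ring

theorem isTempered_regSymbol {ε : ℝ} (hε : 0 < ε) (β : ℂ) : IsTempered (regSymbol d ε β) := by
  have hm := (continuous_regSymbol (d := d) hε β).aestronglyMeasurable (μ := volume)
  rcases le_total 0 β.re with hβ | hβ
  · exact isTempered_of_norm_le hm _ _ (norm_regSymbol_le_of_nonneg hε hβ)
  · refine isTempered_of_norm_le hm ((ε ^ 2) ^ β.re * Real.exp (Real.pi * |β.im|)) 0 fun ζ => ?_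
    rw [pow_zero, mul_one]
    refine (norm_cpow_le_rpow_mul
      (Complex.slitPlane_ne_zero (regSymbol_base_mem_slitPlane hε ζ)) β).trans ?_
    refine mul_le_mul_of_nonneg_right ?_ (Real.exp_pos _).le
    exact Real.rpow_le_rpow_of_nonpos (by positivity) (sq_le_norm_regSymbol_base hε ζ) hβ

/-- The Fourier transform is self-adjoint for the bilinear pairing of integrable functions. -/
theorem integral_fourier_mul_eq_flip {k g : Spacetime d → ℂ} (hk : Integrable k)
    (hg : Integrable g) :
    ∫ ζ, (∫ z, Complex.exp (-(Complex.I * (inner ℝ z ζ : ℝ))) * k z) * g ζ =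
      ∫ z, k z * ∫ ζ, Complex.exp (-(Complex.I * (inner ℝ ζ z : ℝ))) * g ζ := by
  have h := VectorFourier.integral_fourierIntegral_smul_eq_flip (e := Real.fourierChar)
    (L := (2 * Real.pi)⁻¹ • innerₗ (Spacetime d)) (μ := volume) (ν := volume)
    Real.continuous_fourierChar (by
      simp only [LinearMap.smul_apply, innerₗ_apply_apply]
      fun_prop) hk hg
  have hpi : (Real.pi : ℂ) ≠ 0 := by exact_mod_cast Real.pi_ne_zero
  simp only [VectorFourier.fourierIntegral, LinearMap.flip_apply, LinearMap.smul_apply,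
    innerₗ_apply_apply, Circle.smul_def, Real.fourierChar_apply, smul_eq_mul] at h
  have e : ∀ x : ℝ, Complex.exp (((2 * Real.pi * -((2 * Real.pi)⁻¹ * x) : ℝ) : ℂ) * Complex.I) =
      Complex.exp (-(Complex.I * x)) := fun x => by
    congr 1
    push_cast
    field_simp
  simp only [e] at h
  rw [h]
  simp only [real_inner_comm]

/-- The regularized symbol, paired with `φ`, is the damped Riesz kernel paired with `φ̂`. -/
theorem integral_regSymbol_mul (hd : 1 ≤ d) {α : ℂ} (hα : ((d : ℝ) + 1) / 2 - 1 < α.re)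
    {ε : ℝ} (hε : 0 < ε) (φ : 𝓢(Spacetime d, ℂ)) :
    ∫ ζ, regSymbol d ε (-α) ζ * φ ζ =
      ∫ z, rieszKernel d α z * Complex.exp (-((ε : ℂ) * time z)) * angularFourier d φ z := by
  have hk := (isTempered_rieszKernel hd hα).integrable_mul_cexp
    (fun z hz => rieszKernel_of_notMem α hz) (s := (ε : ℂ)) (by simpa using hε)
  have h := integral_fourier_mul_eq_flip hk φ.integrable
  simp only [← angularFourier_apply, integral_rieszKernel_mul_cexp hd hα hε] at h
  exact h

/-- Removal of the damping factor `e^{-εt}` by dominated convergence. -/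
theorem tendsto_integral_regSymbol_mul (hd : 1 ≤ d) {α : ℂ}
    (hα : ((d : ℝ) + 1) / 2 - 1 < α.re) (φ : 𝓢(Spacetime d, ℂ)) :
    Tendsto (fun ε : ℝ => ∫ ζ, regSymbol d ε (-α) ζ * φ ζ) (𝓝[>] 0)
      (𝓝 (regularDist (rieszKernel d α) (angularFourier d φ))) := by
  have ht := isTempered_rieszKernel (d := d) hd hα
  have hi := integrable_mul_schwartz ht (angularFourier d φ)
  rw [regularDist_apply ht]
  have hlim : Tendsto (fun ε : ℝ => ∫ z, rieszKernel d α z * Complex.exp (-((ε : ℂ) * time z)) *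
      angularFourier d φ z) (𝓝[>] 0) (𝓝 (∫ z, rieszKernel d α z * angularFourier d φ z)) := by
    refine tendsto_integral_filter_of_dominated_convergence _ ?_ ?_ hi.norm ?_
    · refine Eventually.of_forall fun ε => ?_
      refine Measurable.aestronglyMeasurable ?_
      have h1 := measurable_rieszKernel (d := d) α
      have h2 := (continuous_time (d := d)).measurable
      have h3 := (angularFourier d φ).continuous.measurable
      fun_prop
    · filter_upwards [self_mem_nhdsWithin] with ε hε
      refine Eventually.of_forall fun z => ?_
      have hε : 0 < ε := hε
      by_cases hz : z ∈ causalCone d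
      · rw [norm_mul, norm_mul, norm_mul, Complex.norm_exp]
        have : Real.exp (-((ε : ℂ) * time z)).re ≤ 1 := by
          rw [Real.exp_le_one_iff]
          simpa using mul_nonneg hε.le hz.2
        gcongr
        exact mul_le_of_le_one_right (norm_nonneg _) this
      · rw [rieszKernel_of_notMem α hz]
        simp
    · refine Eventually.of_forall fun z => ?_
      have : Continuous fun ε : ℝ => rieszKernel d α z * Complex.exp (-((ε : ℂ) * time z)) *
          angularFourier d φ z := by fun_prop
      have := this.tendsto 0
      simp only [Complex.ofReal_zero, zero_mul, neg_zero, Complex.exp_zero, mul_one] at this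
      exact this.mono_left nhdsWithin_le_nhds
  refine hlim.congr' ?_
  filter_upwards [self_mem_nhdsWithin] with ε hε
  exact (integral_regSymbol_mul hd hα hε φ).symm

/-- The wave operator on Schwartz functions. -/
def schwartzBox (φ : 𝓢(Spacetime d, ℂ)) : 𝓢(Spacetime d, ℂ) :=
  ∂_{(EuclideanSpace.single 0 1 : Spacetime d)} (∂_{(EuclideanSpace.single 0 1 : Spacetime d)} φ) -
    ∑ i : Fin d, ∂_{(EuclideanSpace.single i.succ 1 : Spacetime d)}
      (∂_{(EuclideanSpace.single i.succ 1 : Spacetime d)} φ)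

theorem box_apply (T : 𝓢'(Spacetime d, ℂ)) (φ : 𝓢(Spacetime d, ℂ)) :
    box T φ = T (schwartzBox φ) := by
  have h : ∀ m : Spacetime d, (∂_{m} (∂_{m} T)) φ = T (∂_{m} (∂_{m} φ)) := fun m => by
    rw [TemperedDistribution.lineDerivOp_apply_apply, TemperedDistribution.lineDerivOp_apply_apply,
      LineDeriv.lineDerivOp_neg, neg_neg]
  rw [box, schwartzBox, map_sub, map_sum]
  simp [h]

theorem iterate_box_apply (k : ℕ) (T : 𝓢'(Spacetime d, ℂ)) (φ : 𝓢(Spacetime d, ℂ)) :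
    box^[k] T φ = T (schwartzBox^[k] φ) := by
  induction k generalizing φ with
  | zero => rfl
  | succ k ih =>
    rw [Function.iterate_succ_apply', box_apply, ih, ← Function.iterate_succ_apply]

/-- The symbol `|ξ|² - τ²` of the wave operator. -/
def waveSymbol (ζ : Spacetime d) : ℂ := (spaceSq ζ : ℂ) - (time ζ : ℂ) ^ 2

theorem hasTemperateGrowth_time :
    Function.HasTemperateGrowth fun ζ : Spacetime d => (time ζ : ℂ) :=
  (Complex.ofRealCLM ∘L EuclideanSpace.proj (0 : Fin (d + 1))).hasTemperateGrowth

theorem hasTemperateGrowth_waveSymbol :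
    Function.HasTemperateGrowth (waveSymbol : Spacetime d → ℂ) := by
  have h : (waveSymbol : Spacetime d → ℂ) = fun ζ =>
      ((‖ζ‖ ^ 2 : ℝ) : ℂ) - 2 * ((time ζ : ℂ) * (time ζ : ℂ)) := by
    ext ζ
    rw [waveSymbol, ← norm_space_sq, norm_sq_eq]
    push_cast
    ring
  rw [h]
  have h1 := hasTemperateGrowth_time (d := d)
  have h2 : Function.HasTemperateGrowth fun ζ : Spacetime d => ((‖ζ‖ ^ 2 : ℝ) : ℂ) :=
    by fun_prop
  exact h2.sub ((Function.HasTemperateGrowth.const 2).mul (h1.mul h1))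

/-- Multiplication of a Schwartz function by the symbol of the wave operator. -/
def mulWave (d : ℕ) : 𝓢(Spacetime d, ℂ) →L[ℂ] 𝓢(Spacetime d, ℂ) :=
  SchwartzMap.smulLeftCLM ℂ waveSymbol

theorem mulWave_apply (φ : 𝓢(Spacetime d, ℂ)) (ζ : Spacetime d) :
    mulWave d φ ζ = waveSymbol ζ * φ ζ :=
  SchwartzMap.smulLeftCLM_apply_apply hasTemperateGrowth_waveSymbol φ ζ

theorem lineDeriv_angularFourier (m : Spacetime d) (φ : 𝓢(Spacetime d, ℂ)) :
    ∂_{m} (angularFourier d φ) =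
      angularFourier d (-Complex.I • SchwartzMap.smulLeftCLM ℂ (inner ℝ · m) φ) := by
  have hd : dilation d m = (2 * Real.pi)⁻¹ • m := rfl
  have hpi : (Real.pi : ℂ) ≠ 0 := by exact_mod_cast Real.pi_ne_zero
  have h : ∀ ψ : 𝓢(Spacetime d, ℂ), angularFourier d ψ =
    SchwartzMap.compCLMOfContinuousLinearEquiv ℂ (dilation d) (𝓕 ψ) := fun ψ => rfl
  rw [h, h, SchwartzMap.lineDerivOp_compCLMOfContinuousLinearEquiv, hd,
    LineDeriv.lineDerivOp_left_smul, SchwartzMap.lineDerivOp_fourier_eq,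
    FourierTransform.fourier_smul, FourierTransform.fourier_smul]
  congr 1
  ext ζ
  simp only [smul_apply, smul_eq_mul, Complex.real_smul]
  push_cast
  field_simp

theorem angularFourier_lineDeriv (m : Spacetime d) (φ : 𝓢(Spacetime d, ℂ)) (ζ : Spacetime d) :
    angularFourier d (∂_{m} φ) ζ = Complex.I * (inner ℝ ζ m : ℝ) * angularFourier d φ ζ := by
  have h : ∀ ψ : 𝓢(Spacetime d, ℂ), angularFourier d ψ ζ = 𝓕 ψ ((2 * Real.pi)⁻¹ • ζ) :=
    fun ψ => rfl
  have hm : (inner ℝ · m : Spacetime d → ℝ).HasTemperateGrowth := by fun_prop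
  have hpi : (Real.pi : ℂ) ≠ 0 := by exact_mod_cast Real.pi_ne_zero
  rw [h, h, SchwartzMap.fourier_lineDerivOp_eq, smul_apply,
    SchwartzMap.smulLeftCLM_apply_apply hm, inner_smul_left, smul_eq_mul, Complex.real_smul]
  simp only [conj_trivial]
  push_cast
  field_simp

theorem inner_single (ζ : Spacetime d) (i : Fin (d + 1)) :
    inner ℝ ζ (EuclideanSpace.single i 1 : Spacetime d) = ζ i := by
  simp [EuclideanSpace.inner_single_right]

theorem schwartzBox_angularFourier (φ : 𝓢(Spacetime d, ℂ)) :
    schwartzBox (angularFourier d φ) = angularFourier d (mulWave d φ) := by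
  simp only [schwartzBox, lineDeriv_angularFourier]
  rw [← map_sum, ← map_sub]
  congr 1
  ext ζ
  have hm : ∀ (m : Spacetime d) (ψ : 𝓢(Spacetime d, ℂ)),
      SchwartzMap.smulLeftCLM ℂ (inner ℝ · m) ψ ζ = (inner ℝ ζ m : ℝ) * ψ ζ := fun m ψ =>
    SchwartzMap.smulLeftCLM_apply_apply (by fun_prop) ψ ζ
  rw [mulWave_apply, waveSymbol, spaceSq, time, sub_apply, sum_apply]
  simp only [smul_apply, hm, smul_eq_mul]
  simp only [inner_single]
  push_cast
  rw [sub_mul, Finset.sum_mul, sub_eq_add_neg, add_comm, sub_eq_add_neg, ← Finset.sum_neg_distrib]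
  congr 1
  · refine Finset.sum_congr rfl fun i _ => ?_
    linear_combination (-(ζ i.succ : ℂ) ^ 2 * φ ζ) * Complex.I_sq
  · linear_combination ((ζ 0 : ℂ) ^ 2 * φ ζ) * Complex.I_sq

theorem angularFourier_schwartzBox (φ : 𝓢(Spacetime d, ℂ)) :
    angularFourier d (schwartzBox φ) = mulWave d (angularFourier d φ) := by
  ext ζ
  rw [schwartzBox, map_sub, map_sum, sub_apply, sum_apply]
  simp only [angularFourier_lineDeriv, inner_single]
  rw [mulWave_apply, waveSymbol, spaceSq, time]
  push_cast
  rw [sub_mul, Finset.sum_mul, sub_eq_add_neg, add_comm, sub_eq_add_neg, ← Finset.sum_neg_distrib]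
  congr 1
  · refine Finset.sum_congr rfl fun i _ => ?_
    linear_combination (-(ζ i.succ : ℂ) ^ 2 * angularFourier d φ ζ) * Complex.I_sq
  · linear_combination ((ζ 0 : ℂ) ^ 2 * angularFourier d φ ζ) * Complex.I_sq

/-! ### The symbol as a limit, and analyticity -/

theorem regSymbol_neg_eq_mul {ε : ℝ} (hε : 0 < ε) (α : ℂ) (ζ : Spacetime d) :
    regSymbol d ε (-α) ζ =
      (waveSymbol ζ + (ε : ℂ) ^ 2 + 2 * Complex.I * ε * time ζ) *
        regSymbol d ε (-(α + 1)) ζ := by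
  have h0 := Complex.slitPlane_ne_zero (regSymbol_base_mem_slitPlane hε ζ)
  have e : waveSymbol ζ + (ε : ℂ) ^ 2 + 2 * Complex.I * ε * time ζ =
      (spaceSq ζ : ℂ) - ((time ζ : ℂ) - Complex.I * ε) ^ 2 := by
    rw [waveSymbol]
    linear_combination (ε : ℂ) ^ 2 * Complex.I_sq
  rw [e, regSymbol, regSymbol]
  generalize (spaceSq ζ : ℂ) - ((time ζ : ℂ) - Complex.I * ε) ^ 2 = b at h0
  have e' : -α = 1 + -(α + 1) := by ring
  rw [e', Complex.cpow_add _ _ h0, Complex.cpow_one]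

/-- Lowering `α` by one multiplies the regularized symbol by a polynomial that tends to the symbol
of the wave operator, so the limit for `α + k` yields the one for `α`. -/
theorem tendsto_regSymbol_iterate (hd : 1 ≤ d) (k : ℕ) {α : ℂ}
    (hα : ((d : ℝ) + 1) / 2 - 1 < α.re + k) (φ : 𝓢(Spacetime d, ℂ)) :
    Tendsto (fun ε : ℝ => ∫ ζ, regSymbol d ε (-α) ζ * φ ζ) (𝓝[>] 0)
      (𝓝 (box^[k] (regularDist (rieszKernel d (α + k))) (angularFourier d φ))) := by
  induction k generalizing α φ with
  | zero =>
    have := tendsto_integral_regSymbol_mul (d := d) hd (α := α) (by simpa using hα) φ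
    simpa using this
  | succ k ih =>
    have hα' : ((d : ℝ) + 1) / 2 - 1 < (α + 1).re + k := by
      push_cast at hα
      rw [Complex.add_re, Complex.one_re]
      linarith
    have e : α + ((k + 1 : ℕ) : ℂ) = α + 1 + k := by
      push_cast
      ring
    rw [e, Function.iterate_succ_apply', box_apply, schwartzBox_angularFourier]
    have hε : Tendsto (fun ε : ℝ => (ε : ℂ)) (𝓝[>] 0) (𝓝 0) := by
      have := (Complex.continuous_ofReal.tendsto 0).mono_left
        (nhdsWithin_le_nhds (s := Set.Ioi (0 : ℝ)))
      rwa [Complex.ofReal_zero] at this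
    -- the factor `waveSymbol + ε² + 2iετ` is moved to the test function
    set τφ := SchwartzMap.smulLeftCLM ℂ (fun ζ : Spacetime d => (time ζ : ℂ)) φ with hτφ
    have hτ : ∀ ζ, τφ ζ = time ζ * φ ζ := fun ζ =>
      SchwartzMap.smulLeftCLM_apply_apply hasTemperateGrowth_time φ ζ
    have hlim := ((ih hα' (mulWave d φ)).add ((hε.pow 2).mul (ih hα' φ))).add
      ((hε.const_mul (2 * Complex.I)).mul (ih hα' τφ))
    simp only [ne_eq, OfNat.ofNat_ne_zero, not_false_eq_true, zero_pow, zero_mul, add_zero,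
      mul_zero] at hlim
    refine hlim.congr' ?_
    filter_upwards [self_mem_nhdsWithin] with ε hε
    have hε : 0 < ε := hε
    have ht := isTempered_regSymbol (d := d) hε (-(α + 1))
    have i1 := integrable_mul_schwartz ht (mulWave d φ)
    have i2 := (integrable_mul_schwartz ht φ).const_mul ((ε : ℂ) ^ 2)
    have i3 := (integrable_mul_schwartz ht τφ).const_mul (2 * Complex.I * ε)
    rw [← integral_const_mul, ← integral_const_mul, ← integral_add i1 i2,
      ← integral_add (by exact i1.add i2) i3]
    refine integral_congr_ae (Eventually.of_forall fun ζ => ?_)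
    simp only
    rw [regSymbol_neg_eq_mul hε α, mulWave_apply, hτ]
    ring

theorem lt_re_add_rieszShift (α : ℂ) :
    ((d : ℝ) + 1) / 2 - 1 < α.re + rieszShift d α := by
  have hne : {k : ℕ | ((d : ℝ) + 1) / 2 - 1 < α.re + k}.Nonempty := by
    obtain ⟨k, hk⟩ := exists_nat_gt (((d : ℝ) + 1) / 2 - 1 - α.re)
    exact ⟨k, by
      change ((d : ℝ) + 1) / 2 - 1 < α.re + k
      linarith⟩
  exact Nat.sInf_mem hne

theorem tendsto_regSymbol (hd : 1 ≤ d) (α : ℂ) (φ : 𝓢(Spacetime d, ℂ)) :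
    Tendsto (fun ε : ℝ => ∫ ζ, regSymbol d ε (-α) ζ * φ ζ) (𝓝[>] 0)
      (𝓝 (rieszDist d α (angularFourier d φ))) :=
  tendsto_regSymbol_iterate hd _ (lt_re_add_rieszShift α) φ

/-- `R_α = □^k R_{α+k}` for every `k` for which the right hand side is defined by an integral:
both sides are the limit of the same family. -/
theorem rieszDist_apply (hd : 1 ≤ d) {k : ℕ} {α : ℂ} (hα : ((d : ℝ) + 1) / 2 - 1 < α.re + k)
    (φ : 𝓢(Spacetime d, ℂ)) :
    rieszDist d α φ = ∫ z, rieszKernel d (α + k) z * schwartzBox^[k] φ z := by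
  have h := tendsto_nhds_unique (tendsto_regSymbol hd α (angularFourierInv d φ))
    (tendsto_regSymbol_iterate hd k hα (angularFourierInv d φ))
  rw [angularFourier_inv] at h
  rw [h, iterate_box_apply, regularDist_apply]
  exact isTempered_rieszKernel hd (by simpa using hα)

theorem tendsto_regularDist_regSymbol (hd : 1 ≤ d) (β : ℂ) :
    Tendsto (fun ε : ℝ => regularDist (regSymbol d ε β)) (𝓝[>] 0)
      (𝓝 (distFourier d (rieszDist d (-β)))) := by
  refine PointwiseConvergenceCLM.tendsto_iff_forall_tendsto.2 fun φ => ?_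
  have h := tendsto_regSymbol hd (-β) φ
  rw [neg_neg] at h
  refine h.congr' ?_
  filter_upwards [self_mem_nhdsWithin] with ε hε
  exact (regularDist_apply (isTempered_regSymbol hε β) φ).symm

/-- This is `R̂_α = σ_{-α}`, for every `α`. -/
theorem symbolDist_eq (hd : 1 ≤ d) (β : ℂ) :
    symbolDist d β = distFourier d (rieszDist d (-β)) :=
  (tendsto_regularDist_regSymbol hd β).limUnder_eq

theorem differentiable_rieszConst : Differentiable ℂ (rieszConst d) := by
  have h : rieszConst d = fun α => (2 : ℂ) ^ (1 - 2 * α) *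
      (Real.pi : ℂ) ^ (1 - ((d : ℂ) + 1) / 2) *
      ((Complex.Gamma α)⁻¹ * (Complex.Gamma (α + 1 - ((d : ℂ) + 1) / 2))⁻¹) := by
    ext α
    rw [rieszConst, div_eq_mul_inv, mul_inv]
  rw [h]
  have h1 : Differentiable ℂ fun α : ℂ => (2 : ℂ) ^ (1 - 2 * α) := fun α =>
    DifferentiableAt.const_cpow (by fun_prop) (Or.inl two_ne_zero)
  have h2 : Differentiable ℂ fun α : ℂ => (Complex.Gamma (α + 1 - ((d : ℂ) + 1) / 2))⁻¹ :=
    Complex.differentiable_one_div_Gamma.comp (by fun_prop)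
  exact (h1.mul_const _).mul (Complex.differentiable_one_div_Gamma.mul h2)

theorem rpow_le_rpow_add_rpow {x p q r : ℝ} (hx : 0 < x) (hqp : q ≤ p) (hpr : p ≤ r) :
    x ^ p ≤ x ^ q + x ^ r := by
  rcases le_total x 1 with h | h
  · exact (Real.rpow_le_rpow_of_exponent_ge hx h hqp).trans (le_add_of_nonneg_right (by positivity))
  · exact (Real.rpow_le_rpow_of_exponent_le h hpr).trans (le_add_of_nonneg_left (by positivity))

theorem differentiableAt_integral_coneKernel (hd : 1 ≤ d) {a : ℂ} (ha : -1 < a.re)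
    (φ : 𝓢(Spacetime d, ℂ)) :
    DifferentiableAt ℂ (fun a => ∫ z, coneKernel d a z * φ z) a := by
  set r : ℝ := (a.re + 1) / 2 with hr
  have hr0 : 0 < r := by linarith
  have i1 := integrable_mul_schwartz
    (isTempered_abs_sq_sub_rpow (d := d) (a := a.re - r) (by linarith) hd) φ
  have i2 := integrable_mul_schwartz
    (isTempered_abs_sq_sub_rpow (d := d) (a := a.re + r) (by linarith) hd) φ
  refine differentiableAt_integral_of_dominated hr0 (fun s _ => ?_) ?_ ?_ (i1.norm.add i2.norm)
  · have := φ.continuous.measurable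
    exact ((measurable_coneKernel s).mul this).aestronglyMeasurable
  · filter_upwards [ae_sq_ne_spaceSq] with z hz
    refine Differentiable.differentiableOn ?_
    by_cases h : z ∈ causalCone d
    · have h0 : ((time z ^ 2 - spaceSq z : ℝ) : ℂ) ≠ 0 := by
        exact_mod_cast sub_ne_zero.2 hz
      simp only [coneKernel, Set.indicator_of_mem h]
      intro s
      exact (DifferentiableAt.const_cpow differentiableAt_id (Or.inl h0)).mul_const _
    · simp only [coneKernel_of_notMem _ h, zero_mul]
      exact differentiable_const _
  · filter_upwards [ae_sq_ne_spaceSq] with z hz s hs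
    have h1 := Complex.abs_re_le_norm (s - a)
    rw [Metric.mem_ball, dist_eq_norm] at hs
    rw [Complex.sub_re, abs_le] at h1
    have hpos : 0 < |time z ^ 2 - spaceSq z| := abs_pos.2 (sub_ne_zero.2 hz)
    have h2 : ‖coneKernel d s z‖ ≤ |time z ^ 2 - spaceSq z| ^ s.re := by
      by_cases h : z ∈ causalCone d
      · rw [coneKernel, Set.indicator_of_mem h]
        exact norm_ofReal_cpow_le_of_nonneg (sub_nonneg.2 h.1) s
      · rw [coneKernel_of_notMem _ h, norm_zero]
        positivity
    have h3 := rpow_le_rpow_add_rpow hpos (p := s.re) (q := a.re - r) (r := a.re + r)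
      (by linarith) (by linarith)
    simp only [Pi.add_apply]
    rw [norm_mul, norm_mul, norm_mul, ← add_mul, Complex.norm_real, Complex.norm_real,
      Real.norm_of_nonneg (by positivity), Real.norm_of_nonneg (by positivity)]
    gcongr
    exact h2.trans h3

/-- Near any point the shift `k` in `R_α = □^k R_{α+k}` can be kept fixed, which reduces the claim
to the holomorphy of the integral of the kernel. -/
theorem differentiable_rieszDist (hd : 1 ≤ d) (φ : 𝓢(Spacetime d, ℂ)) :
    Differentiable ℂ fun α : ℂ => rieszDist d α φ := by
  intro α₀
  set k := rieszShift d α₀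
  have hk : ((d : ℝ) + 1) / 2 - 1 < α₀.re + k := lt_re_add_rieszShift α₀
  have hev : ∀ᶠ α in 𝓝 α₀, ((d : ℝ) + 1) / 2 - 1 < α.re + k := by
    have hc : Continuous fun α : ℂ => α.re + k := by fun_prop
    exact hc.continuousAt.eventually (lt_mem_nhds hk)
  have heq : (fun α : ℂ => rieszDist d α φ) =ᶠ[𝓝 α₀] fun α =>
      rieszConst d (α + k) *
        ∫ z, coneKernel d (α + k - ((d : ℂ) + 1) / 2) z * schwartzBox^[k] φ z := by
    filter_upwards [hev] with α hα
    rw [rieszDist_apply hd hα, ← integral_const_mul]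
    simp only [rieszKernel_eq, mul_assoc]
  refine DifferentiableAt.congr_of_eventuallyEq ?_ heq
  have h1 : DifferentiableAt ℂ (fun α : ℂ => rieszConst d (α + k)) α₀ :=
    (differentiable_rieszConst _).comp α₀ (by fun_prop)
  refine h1.mul ?_
  have h2 := differentiableAt_integral_coneKernel hd (a := α₀ + k - ((d : ℂ) + 1) / 2)
    (neg_one_lt_re (by simpa using hk)) (schwartzBox^[k] φ)
  exact h2.comp α₀ (f := fun α : ℂ => α + k - ((d : ℂ) + 1) / 2) (by fun_prop)

theorem tendsto_regSymbol_symbol (β : ℂ) {ζ : Spacetime d} (hζ : time ζ ^ 2 ≠ spaceSq ζ) :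
    Tendsto (fun ε : ℝ => regSymbol d ε β ζ) (𝓝[>] 0) (𝓝 (symbol d β ζ)) := by
  set Q : ℝ := spaceSq ζ - time ζ ^ 2 with hQ
  set b : ℝ → ℂ := fun ε => (spaceSq ζ : ℂ) - ((time ζ : ℂ) - Complex.I * ε) ^ 2 with hb
  have hlim : Tendsto b (𝓝[>] 0) (𝓝 (Q : ℂ)) := by
    have hc : Continuous b := by fun_prop
    have := (hc.tendsto 0).mono_left (nhdsWithin_le_nhds (s := Set.Ioi (0 : ℝ)))
    have e : b 0 = Q := by simp [hb, hQ]
    rwa [e] at this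
  have him : ∀ ε, (b ε).im = 2 * ε * time ζ := fun ε => by
    simp [hb, pow_two]
    ring
  change Tendsto (fun ε : ℝ => b ε ^ β) _ _
  rcases lt_or_gt_of_ne (show Q ≠ 0 from sub_ne_zero.2 hζ.symm) with h | h
  · have hτ : time ζ ≠ 0 := fun h0 => by
      have h1 : 0 ≤ spaceSq ζ := by
        rw [← norm_space_sq]
        positivity
      rw [hQ, h0] at h
      linarith [h, h1, zero_pow (M₀ := ℝ) two_ne_zero]
    have hQ' : 0 < time ζ ^ 2 - spaceSq ζ := by linarith
    rw [symbol, if_neg (by linarith), if_pos hQ']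
    have hQ0 : ((Q : ℝ) : ℂ) ≠ 0 := by exact_mod_cast h.ne
    have hQ1 : ((time ζ ^ 2 - spaceSq ζ : ℝ) : ℂ) ≠ 0 := by exact_mod_cast hQ'.ne'
    have hnorm : ‖(Q : ℂ)‖ = time ζ ^ 2 - spaceSq ζ := by
      rw [Complex.norm_real, Real.norm_of_nonpos h.le, hQ]
      ring
    have hbne : ∀ᶠ ε in 𝓝[>] (0 : ℝ), b ε ≠ 0 := hlim.eventually_ne hQ0
    have key : ∀ c : ℂ, Tendsto (fun ε => Complex.log (b ε)) (𝓝[>] 0)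
        (𝓝 (Real.log ‖(Q : ℂ)‖ + c)) → Tendsto (fun ε : ℝ => b ε ^ β) (𝓝[>] 0)
        (𝓝 (Complex.exp (c * β) * ((time ζ ^ 2 - spaceSq ζ : ℝ) : ℂ) ^ β)) := by
      intro c hc
      have h1 := (Complex.continuous_exp.tendsto _).comp (hc.mul_const β)
      rw [hnorm, Complex.ofReal_log hQ'.le, add_mul, add_comm, Complex.exp_add,
        ← Complex.cpow_def_of_ne_zero hQ1] at h1
      refine h1.congr' ?_
      filter_upwards [hbne] with ε hε
      exact (Complex.cpow_def_of_ne_zero hε β).symm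
    rcases lt_or_gt_of_ne hτ with hs | hs
    · -- the base approaches the negative axis from below
      have h1 := (Complex.tendsto_log_nhdsWithin_im_neg_of_re_neg_of_im_zero
        (z := (Q : ℂ)) (by rwa [Complex.ofReal_re]) (Complex.ofReal_im _)).comp
        (tendsto_nhdsWithin_iff.2 ⟨hlim, by
          filter_upwards [self_mem_nhdsWithin] with ε hε
          have hε : 0 < ε := hε
          change (b ε).im < 0
          rw [him]
          exact mul_neg_of_pos_of_neg (by positivity) hs⟩)
      have h2 := key (-(Real.pi * Complex.I)) (by rwa [sub_eq_add_neg] at h1)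
      convert h2 using 4
      rw [Real.sign_of_neg hs]
      push_cast
      ring
    · -- the base approaches the negative axis from above
      have h1 := (Complex.tendsto_log_nhdsWithin_im_nonneg_of_re_neg_of_im_zero
        (z := (Q : ℂ)) (by rwa [Complex.ofReal_re]) (Complex.ofReal_im _)).comp
        (tendsto_nhdsWithin_iff.2 ⟨hlim, by
          filter_upwards [self_mem_nhdsWithin] with ε hε
          have hε : 0 < ε := hε
          change 0 ≤ (b ε).im
          rw [him]
          positivity⟩)
      have h2 := key (Real.pi * Complex.I) h1
      convert h2 using 4
      rw [Real.sign_of_pos hs]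
      push_cast
      ring
  · have h' : 0 < spaceSq ζ - time ζ ^ 2 := h
    rw [symbol, if_pos h']
    exact (continuousAt_cpow_const (Complex.ofReal_mem_slitPlane.2 h)).tendsto.comp hlim

/-- A majorant, uniform in `ε`, for passing to the limit under the integral sign. -/
theorem exists_isTempered_norm_regSymbol_le (hd : 1 ≤ d) {β : ℂ} (hβ : -1 < β.re) :
    ∃ g : Spacetime d → ℂ, IsTempered g ∧
      ∀ᶠ ε in 𝓝[>] (0 : ℝ), ∀ᵐ ζ, ‖regSymbol d ε β ζ‖ ≤ ‖g ζ‖ := by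
  rcases le_total 0 β.re with h | h
  · refine ⟨fun ζ => ((2 ^ (2 * ⌈β.re⌉₊) * Real.exp (Real.pi * |β.im|) *
      (1 + ‖ζ‖) ^ (2 * ⌈β.re⌉₊) : ℝ) : ℂ), ?_, ?_⟩
    · refine isTempered_of_norm_le (Continuous.aestronglyMeasurable (by fun_prop))
        (2 ^ (2 * ⌈β.re⌉₊) * Real.exp (Real.pi * |β.im|)) (2 * ⌈β.re⌉₊) fun ζ => ?_
      rw [Complex.norm_real, Real.norm_of_nonneg (by positivity)]
    · filter_upwards [Ioo_mem_nhdsGT (zero_lt_one (α := ℝ))] with ε hε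
      refine Eventually.of_forall fun ζ => (norm_regSymbol_le_of_nonneg hε.1 h ζ).trans ?_
      have h0 := hε.1
      have h1 : 1 + ε ≤ 2 := by linarith [hε.2]
      rw [Complex.norm_real, Real.norm_of_nonneg (by positivity)]
      gcongr
  · refine ⟨fun ζ => (Real.exp (Real.pi * |β.im|) : ℂ) *
      ((|time ζ ^ 2 - spaceSq ζ| ^ β.re : ℝ) : ℂ),
      (isTempered_abs_sq_sub_rpow hβ hd).const_mul _, ?_⟩
    filter_upwards [self_mem_nhdsWithin] with ε hε
    filter_upwards [ae_sq_ne_spaceSq] with ζ hζ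
    refine (norm_cpow_le_rpow_mul
      (Complex.slitPlane_ne_zero (regSymbol_base_mem_slitPlane hε ζ)) β).trans ?_
    rw [norm_mul, Complex.norm_real, Complex.norm_real, Real.norm_of_nonneg (by positivity),
      Real.norm_of_nonneg (by positivity), mul_comm]
    refine mul_le_mul_of_nonneg_left ?_ (Real.exp_pos _).le
    exact Real.rpow_le_rpow_of_nonpos (abs_pos.2 (sub_ne_zero.2 hζ))
      (abs_le_norm_regSymbol_base ε ζ) h

theorem measurable_regSymbol (ε : ℝ) (β : ℂ) : Measurable (regSymbol d ε β) := by
  have h1 := (continuous_time (d := d)).measurable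
  have h2 := (continuous_spaceSq (d := d)).measurable
  unfold regSymbol
  fun_prop

theorem isTempered_symbol (hd : 1 ≤ d) {β : ℂ} (hβ : -1 < β.re) : IsTempered (symbol d β) := by
  obtain ⟨g, hg, hle⟩ := exists_isTempered_norm_regSymbol_le (d := d) hd hβ
  have hlim : ∀ᵐ ζ : Spacetime d, Tendsto (fun ε : ℝ => regSymbol d ε β ζ) (𝓝[>] 0)
      (𝓝 (symbol d β ζ)) := ae_sq_ne_spaceSq.mono fun ζ hζ => tendsto_regSymbol_symbol β hζ
  refine hg.mono (aestronglyMeasurable_of_tendsto_ae _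
    (fun ε => (measurable_regSymbol ε β).aestronglyMeasurable) hlim) ?_
  -- along a sequence, the exceptional null sets of the majorization are countably many
  obtain ⟨u, hu⟩ := exists_seq_tendsto (𝓝[>] (0 : ℝ))
  obtain ⟨N, hN⟩ := eventually_atTop.1 (hu.eventually hle)
  have hN' : ∀ᵐ ζ : Spacetime d, ∀ n, ‖regSymbol d (u (n + N)) β ζ‖ ≤ ‖g ζ‖ :=
    ae_all_iff.2 fun n => hN _ (by omega)
  filter_upwards [hlim, hN'] with ζ h1 h2
  exact le_of_tendsto ((h1.comp (hu.comp (tendsto_add_atTop_nat N))).norm)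
    (Eventually.of_forall h2)

theorem symbolDist_eq_regularDist (hd : 1 ≤ d) {β : ℂ} (hβ : -1 < β.re) :
    symbolDist d β = regularDist (symbol d β) := by
  obtain ⟨g, hg, hle⟩ := exists_isTempered_norm_regSymbol_le (d := d) hd hβ
  ext φ
  have h1 := tendsto_regSymbol (d := d) hd (-β) φ
  rw [neg_neg] at h1
  rw [symbolDist_eq hd, regularDist_apply (isTempered_symbol hd hβ)]
  refine tendsto_nhds_unique h1 ?_
  refine tendsto_integral_filter_of_dominated_convergence _ ?_ ?_
    (integrable_mul_schwartz hg φ).norm ?_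
  · refine Eventually.of_forall fun ε => ?_
    exact ((measurable_regSymbol ε β).mul φ.continuous.measurable).aestronglyMeasurable
  · filter_upwards [hle] with ε hε
    filter_upwards [hε] with ζ hζ
    rw [norm_mul, norm_mul]
    gcongr
  · filter_upwards [ae_sq_ne_spaceSq] with ζ hζ
    exact (tendsto_regSymbol_symbol β hζ).mul_const _

/-! ### Riesz potentials -/

theorem exists_schwartz_translate_le (g : 𝓢(Spacetime d, ℂ)) (N : ℕ) :
    ∃ C : ℝ, 0 ≤ C ∧ ∀ z w, ‖g (z - w)‖ ≤ C * (1 + ‖z‖) ^ N * ((1 + ‖w‖) ^ N)⁻¹ := by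
  refine ⟨2 ^ N * (Finset.Iic (N, 0)).sup (fun m : ℕ × ℕ => SchwartzMap.seminorm ℂ m.1 m.2) g,
    by positivity, fun z w => ?_⟩
  have h := SchwartzMap.one_add_le_sup_seminorm_apply (𝕜 := ℂ) (m := (N, 0))
    (le_refl N) (le_refl 0) g (z - w)
  rw [norm_iteratedFDeriv_zero] at h
  have h1 : 1 + ‖w‖ ≤ (1 + ‖z - w‖) * (1 + ‖z‖) := by
    have h2 : ‖w‖ ≤ ‖z‖ + ‖z - w‖ := by
      have := norm_sub_le z (z - w)
      rwa [sub_sub_cancel] at this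
    nlinarith [mul_nonneg (norm_nonneg (z - w)) (norm_nonneg z)]
  have h0 : (0 : ℝ) < (1 + ‖w‖) ^ N := by positivity
  rw [← div_eq_mul_inv, le_div_iff₀ h0]
  calc ‖g (z - w)‖ * (1 + ‖w‖) ^ N ≤ ‖g (z - w)‖ * ((1 + ‖z - w‖) * (1 + ‖z‖)) ^ N := by gcongr
    _ = ((1 + ‖z - w‖) ^ N * ‖g (z - w)‖) * (1 + ‖z‖) ^ N := by
      rw [mul_pow]
      ring
    _ ≤ _ := by gcongr

/-- The weight that makes `K` integrable is moved from `w` to `z`, at the cost of the decay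
of `g`. -/
theorem IsTempered.exists_convolution_bound {K : Spacetime d → ℂ} (hK : IsTempered K)
    (g : 𝓢(Spacetime d, ℂ)) :
    ∃ (N : ℕ) (b : Spacetime d → ℝ), Integrable b ∧
      ∀ z w, ‖K w * g (z - w)‖ ≤ (1 + ‖z‖) ^ N * b w := by
  obtain ⟨N, hN⟩ := hK
  obtain ⟨C, hC0, hC⟩ := exists_schwartz_translate_le g N
  refine ⟨N, _, hN.norm.const_mul C, fun z w => ?_⟩
  rw [norm_mul, norm_smul, Real.norm_of_nonneg (by positivity)]
  calc ‖K w‖ * ‖g (z - w)‖ ≤ ‖K w‖ * (C * (1 + ‖z‖) ^ N * ((1 + ‖w‖) ^ N)⁻¹) := by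
        gcongr
        exact hC z w
    _ = _ := by ring

theorem IsTempered.continuous_convolution {K : Spacetime d → ℂ} (hK : IsTempered K)
    (g : 𝓢(Spacetime d, ℂ)) :
    Continuous fun z => ∫ w, K w * g (z - w) := by
  obtain ⟨N, b, hb, hle⟩ := hK.exists_convolution_bound g
  refine continuous_iff_continuousAt.2 fun z₀ => ?_
  refine continuousAt_of_dominated (bound := fun w => (1 + (‖z₀‖ + 1)) ^ N * b w) ?_ ?_
    (hb.const_mul _) ?_
  · refine Eventually.of_forall fun z => hK.aestronglyMeasurable.mul ?_
    have := g.continuous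
    exact Continuous.aestronglyMeasurable (by fun_prop)
  · filter_upwards [Metric.ball_mem_nhds z₀ one_pos] with z hz
    refine Eventually.of_forall fun w => (hle z w).trans ?_
    have hb0 : 0 ≤ b w := by
      have := (norm_nonneg _).trans (hle 0 w)
      simpa using this
    have hz' : ‖z‖ ≤ ‖z₀‖ + 1 := by
      rw [Metric.mem_ball, dist_eq_norm] at hz
      linarith [norm_le_norm_add_norm_sub z₀ z, norm_sub_rev z z₀]
    gcongr
  · refine Eventually.of_forall fun w => ?_
    have := g.continuous
    exact Continuous.continuousAt (by fun_prop)

theorem IsTempered.convolution {K : Spacetime d → ℂ} (hK : IsTempered K)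
    (g : 𝓢(Spacetime d, ℂ)) :
    IsTempered fun z => ∫ w, K w * g (z - w) := by
  obtain ⟨N, b, hb, hle⟩ := hK.exists_convolution_bound g
  refine isTempered_of_norm_le (hK.continuous_convolution g).aestronglyMeasurable (∫ w, b w) N
    fun z => ?_
  rw [mul_comm, ← integral_const_mul]
  exact norm_integral_le_of_norm_le (hb.const_mul _) (Eventually.of_forall (hle z))

theorem IsTempered.integral_convolution_mul {K : Spacetime d → ℂ} (hK : IsTempered K)
    (g : 𝓢(Spacetime d, ℂ))
    (φ : 𝓢(Spacetime d, ℂ)) :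
    ∫ z, (∫ w, K w * g (z - w)) * φ z = ∫ w, K w * ∫ z, g (z - w) * φ z := by
  obtain ⟨N, b, hb, hle⟩ := hK.exists_convolution_bound g
  have hw : Integrable fun z : Spacetime d => (((1 + ‖z‖) ^ N : ℝ) : ℂ) * φ z := by
    refine integrable_mul_schwartz (isTempered_of_norm_le
      (Continuous.aestronglyMeasurable (by fun_prop)) 1 N fun z => ?_) φ
    rw [Complex.norm_real, Real.norm_of_nonneg (by positivity), one_mul]
  have hi : Integrable (Function.uncurry fun z w => K w * g (z - w) * φ z)
      (volume.prod volume) := by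
    refine (hw.norm.mul_prod hb).mono' ?_ (Eventually.of_forall fun p => ?_)
    · have h1 := g.continuous
      have h2 := φ.continuous
      refine (hK.aestronglyMeasurable.comp_snd.mul
        (Continuous.aestronglyMeasurable (f := fun p : Spacetime d × Spacetime d =>
          g (p.1 - p.2)) (by fun_prop))).mul
        (Continuous.aestronglyMeasurable (f := fun p : Spacetime d × Spacetime d => φ p.1)
          (by fun_prop))
    · simp only [Function.uncurry]
      rw [norm_mul, norm_mul _ (φ p.1), Complex.norm_real, Real.norm_of_nonneg (by positivity)]
      calc ‖K p.2 * g (p.1 - p.2)‖ * ‖φ p.1‖ ≤ (1 + ‖p.1‖) ^ N * b p.2 * ‖φ p.1‖ := by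
            gcongr
            exact hle _ _
        _ = _ := by ring
  simp only [← integral_mul_const, ← integral_const_mul]
  rw [integral_integral_swap hi]
  simp only [mul_assoc]

/-- The Fourier transform of `ĝ h` is the convolution of `ĥ` with the reflection of `g`. -/
theorem angularFourier_smulLeft (g h : 𝓢(Spacetime d, ℂ)) (w : Spacetime d) :
    angularFourier d (SchwartzMap.smulLeftCLM ℂ (angularFourier d g) h) w =
      ∫ z, g (z - w) * angularFourier d h z := by
  have hi : Integrable fun ζ => Complex.exp (-(Complex.I * (inner ℝ ζ w : ℝ))) * h ζ := by
    refine h.integrable.bdd_mul (c := 1) (Continuous.aestronglyMeasurable (by fun_prop))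
      (Eventually.of_forall fun ζ => ?_)
    rw [Complex.norm_exp]
    simp
  have hflip := integral_fourier_mul_eq_flip g.integrable hi
  simp only [← angularFourier_apply] at hflip
  rw [angularFourier_apply, ← integral_sub_right_eq_self (fun z => g (z - w) * _) (-w)]
  simp only [sub_neg_eq_add, add_sub_cancel_right]
  have e1 : ∀ ζ, Complex.exp (-(Complex.I * (inner ℝ ζ w : ℝ))) *
      SchwartzMap.smulLeftCLM ℂ (angularFourier d g) h ζ =
      angularFourier d g ζ * (Complex.exp (-(Complex.I * (inner ℝ ζ w : ℝ))) * h ζ) := fun ζ => by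
    rw [SchwartzMap.smulLeftCLM_apply_apply (angularFourier d g).hasTemperateGrowth, smul_eq_mul]
    ring
  simp only [e1]
  rw [hflip]
  refine integral_congr_ae (Eventually.of_forall fun y => ?_)
  simp only
  rw [angularFourier_apply]
  congr 2
  ext ζ
  rw [← mul_assoc, ← Complex.exp_add, inner_add_right]
  congr 2
  push_cast
  ring

theorem lineDeriv_reflectTranslate (m : Spacetime d) (f : 𝓢(Spacetime d, ℂ)) (z : Spacetime d) :
    ∂_{m} (reflectTranslate f z) = -reflectTranslate (∂_{m} f) z := by
  ext w
  have h : (reflectTranslate f z : Spacetime d → ℂ) = fun w => f (z - w) :=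
    funext fun w => reflectTranslate_apply f z w
  have h' : HasFDerivAt (fun w => f (z - w)) _ w :=
    (f.differentiableAt.hasFDerivAt (x := z - w)).comp w ((hasFDerivAt_id w).const_sub z)
  rw [neg_apply, reflectTranslate_apply, SchwartzMap.lineDerivOp_apply_eq_fderiv,
    SchwartzMap.lineDerivOp_apply_eq_fderiv, h, h'.fderiv]
  simp

theorem schwartzBox_reflectTranslate (f : 𝓢(Spacetime d, ℂ)) (z : Spacetime d) :
    schwartzBox (reflectTranslate f z) = reflectTranslate (schwartzBox f) z := by
  have h : ∀ m : Spacetime d, ∂_{m} (∂_{m} (reflectTranslate f z)) =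
      reflectTranslate (∂_{m} (∂_{m} f)) z := fun m => by
    rw [lineDeriv_reflectTranslate, LineDeriv.lineDerivOp_neg, lineDeriv_reflectTranslate, neg_neg]
  ext w
  simp only [schwartzBox, h]
  simp [reflectTranslate_apply]

theorem iterate_schwartzBox_reflectTranslate (k : ℕ) (f : 𝓢(Spacetime d, ℂ)) (z : Spacetime d) :
    schwartzBox^[k] (reflectTranslate f z) = reflectTranslate (schwartzBox^[k] f) z :=
  (Function.Semiconj.iterate_right (f := (reflectTranslate · z))
    (fun f => (schwartzBox_reflectTranslate f z).symm) k f).symm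

theorem iterate_schwartzBox_angularFourier (k : ℕ) (φ : 𝓢(Spacetime d, ℂ)) :
    schwartzBox^[k] (angularFourier d φ) = angularFourier d ((mulWave d)^[k] φ) :=
  (Function.Semiconj.iterate_right (f := angularFourier d)
    (fun φ => (schwartzBox_angularFourier φ).symm) k φ).symm

theorem angularFourier_iterate_schwartzBox (k : ℕ) (φ : 𝓢(Spacetime d, ℂ)) :
    angularFourier d (schwartzBox^[k] φ) = (mulWave d)^[k] (angularFourier d φ) :=
  Function.Semiconj.iterate_right (f := angularFourier d) angularFourier_schwartzBox k φ

theorem iterate_mulWave_apply (k : ℕ) (φ : 𝓢(Spacetime d, ℂ)) (ζ : Spacetime d) :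
    (mulWave d)^[k] φ ζ = waveSymbol ζ ^ k * φ ζ := by
  induction k generalizing φ with
  | zero => simp
  | succ k ih =>
    rw [Function.iterate_succ_apply, ih, mulWave_apply]
    ring

theorem iterate_schwartzBox_convolution (k : ℕ) (f h : 𝓢(Spacetime d, ℂ)) :
    schwartzBox^[k] (angularFourier d (SchwartzMap.smulLeftCLM ℂ (angularFourier d f) h)) =
      angularFourier d
        (SchwartzMap.smulLeftCLM ℂ (angularFourier d (schwartzBox^[k] f)) h) := by
  rw [iterate_schwartzBox_angularFourier]
  congr 1
  ext ζ
  rw [iterate_mulWave_apply,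
    SchwartzMap.smulLeftCLM_apply_apply (angularFourier d f).hasTemperateGrowth,
    SchwartzMap.smulLeftCLM_apply_apply (angularFourier d _).hasTemperateGrowth,
    angularFourier_iterate_schwartzBox, iterate_mulWave_apply, smul_eq_mul, smul_eq_mul, mul_assoc]

/-- The Riesz potential is the convolution of a tempered function with a Schwartz function, because
all the derivatives in `R_α = □^k R_{α+k}` fall on the latter. -/
theorem rieszPotential_eq (α : ℂ) (f : 𝓢(Spacetime d, ℂ)) (hd : 1 ≤ d) :
    rieszPotential α f = fun z => ∫ w, rieszKernel d (α + rieszShift d α) w *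
      schwartzBox^[rieszShift d α] f (z - w) := by
  ext z
  rw [rieszPotential, rieszDist_apply hd (lt_re_add_rieszShift α)]
  simp only [iterate_schwartzBox_reflectTranslate, reflectTranslate_apply]

theorem isTempered_rieszKernel_shift (hd : 1 ≤ d) (α : ℂ) :
    IsTempered (rieszKernel d (α + rieszShift d α)) :=
  isTempered_rieszKernel hd (by simpa using lt_re_add_rieszShift α)

/-- Both sides, paired with `φ`, equal the pairing of `R_{-α}` with `w ↦ ∫ f(z - w) φ(z) dz`. -/
theorem boxPow_eq_regularDist (hd : 1 ≤ d) (α : ℂ) (f : 𝓢(Spacetime d, ℂ)) :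
    boxPow α f = regularDist (rieszPotential (-α) f) := by
  have hK := isTempered_rieszKernel_shift (d := d) hd (-α)
  ext φ
  set h := angularFourierInv d φ with hh
  have hφ : angularFourier d h = φ := angularFourier_inv φ
  have e1 : boxPow α f φ = symbolDist d α (SchwartzMap.smulLeftCLM ℂ (angularFourier d f) h) := rfl
  have e2 : symbolDist d α (SchwartzMap.smulLeftCLM ℂ (angularFourier d f) h) =
      rieszDist d (-α)
        (angularFourier d (SchwartzMap.smulLeftCLM ℂ (angularFourier d f) h)) := by
    rw [symbolDist_eq hd]
    rfl
  rw [e1, e2, rieszDist_apply hd (lt_re_add_rieszShift (-α)), rieszPotential_eq (-α) f hd,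
    regularDist_apply (hK.convolution _), hK.integral_convolution_mul]
  simp only [iterate_schwartzBox_convolution, angularFourier_smulLeft, hφ]

end FracWave

end

theorem proposition2p1 (d : ℕ) (hd : 1 ≤ d) :
    -- the integral defining `R_β` converges absolutely for `Re β > n/2 - 1`, and `R_β` is the
    -- analytic continuation in `β` to the whole plane
    (∀ β : ℂ, ((d : ℝ) + 1) / 2 - 1 < β.re → IsTempered (rieszKernel d β)) ∧
    (∀ φ : 𝓢(Spacetime d, ℂ), Differentiable ℂ fun β : ℂ => rieszDist d β φ) ∧
    -- the limit defining `σ_β` exists in the space of tempered distributions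
    (∀ β : ℂ, (∀ ε : ℝ, 0 < ε → IsTempered (regSymbol d ε β)) ∧
      Tendsto (fun ε : ℝ => regularDist (regSymbol d ε β)) (𝓝[>] 0) (𝓝 (symbolDist d β))) ∧
    -- it is the analytic continuation in `β` of the locally integrable function `symbol d β`
    (∀ β : ℂ, -1 < β.re → IsTempered (symbol d β) ∧ symbolDist d β = regularDist (symbol d β)) ∧
    (∀ φ : 𝓢(Spacetime d, ℂ), DifferentiableOn ℂ (fun β : ℂ => symbolDist d β φ)
      {β : ℂ | ∀ k : ℕ, β + ((d : ℂ) + 1) / 2 ≠ -(k : ℂ)}) ∧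
    -- the Fourier transform of `R_α` is `σ_{-α}`, and `□^α f = I_{-α} f`
    ∀ α : ℂ, (∀ k : ℕ, α + ((d : ℂ) + 1) / 2 ≠ -(k : ℂ)) →
      distFourier d (rieszDist d α) = symbolDist d (-α) ∧
      ∀ (f : Spacetime d → ℂ) (hc : HasCompactSupport f) (hf : ContDiff ℝ ∞ f),
        Continuous (rieszPotential (-α) (hc.toSchwartzMap hf)) ∧
        IsTempered (rieszPotential (-α) (hc.toSchwartzMap hf)) ∧
        boxPow α (hc.toSchwartzMap hf) =
          regularDist (rieszPotential (-α) (hc.toSchwartzMap hf)) := by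
  refine ⟨fun β hβ => isTempered_rieszKernel hd hβ, fun φ => differentiable_rieszDist hd φ,
    fun β => ⟨fun ε hε => isTempered_regSymbol hε β, ?_⟩,
    fun β hβ => ⟨isTempered_symbol hd hβ, symbolDist_eq_regularDist hd hβ⟩, fun φ => ?_,
    fun α _ => ⟨?_, fun f hc hf => ?_⟩⟩
  · rw [symbolDist_eq hd]
    exact tendsto_regularDist_regSymbol hd β
  · have h : (fun β : ℂ => symbolDist d β φ) =
        (fun α : ℂ => rieszDist d α (angularFourier d φ)) ∘ Neg.neg := by
      ext β
      rw [symbolDist_eq hd]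
      rfl
    rw [h]
    exact ((differentiable_rieszDist hd _).comp differentiable_neg).differentiableOn
  · rw [symbolDist_eq hd, neg_neg]
  · have hK := isTempered_rieszKernel_shift (d := d) hd (-α)
    refine ⟨?_, ?_, boxPow_eq_regularDist hd α _⟩
    · rw [rieszPotential_eq _ _ hd]
      exact hK.continuous_convolution _
    · rw [rieszPotential_eq _ _ hd]
      exact hK.convolution _
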